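/- Let $K$ be an algebraically closed field of characteristic $p \ge 0$ with $p \neq 2, 3$, and let $C \subset \mathbb{P}^2$ be an irreducible rational plane curve of degree four over $K$. A point $P \in C$ is called an (inner) Galois point if the extension of function fields $K(C)/\pi_P^*K(\mathbb{P}^1)$ induced by the projection $\pi_P$ from $P$ is Galois. Let $\delta(C)$ be the number of Galois points that are smooth points of $C$, and let $\delta_2(C)$ be the number of those among them with $I_P(C, T_PC) = 4$, where $I_P(C, T_PC)$ is the intersection multiplicity at $P$ of $C$ and its tangent line $T_PC$ at $P$. Then $\delta_2(C) \ge 2$ if and only if $C$ is projectively equivalent to the curve which is the image of the morphism $$\mathbb{P}^1 \to \mathbb{P}^2, \qquad (s:t) \mapsto (s^4 : s(s+t)^3 : t^4).$$ In this case, $\delta(C) = \delta_2(C) = 2$. -/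

import Mathlib

noncomputable section

namespace GaloisPoint

/-- The projective plane over `K`, as a set of points. -/
abbrev Plane (K : Type*) [Field K] : Type _ := Projectivization K (Fin 3 → K)

/-- The projective line over `K`, as a set of points. -/
abbrev Line (K : Type*) [Field K] : Type _ := Projectivization K (Fin 2 → K)

/-- An irreducible plane curve of degree `d`, given by its defining form. -/
structure PlaneCurve (K : Type*) [Field K] (d : ℕ) where
  /-- the defining form -/
  poly : MvPolynomial (Fin 3) K
  isHomogeneous : poly.IsHomogeneous d
  irreducible : Irreducible poly

namespace PlaneCurve

variable {K : Type*} [Field K] {d : ℕ} (C : PlaneCurve K d)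

/-- The set of points of the curve (the form is homogeneous, so that its vanishing at a point does
not depend on the representative). -/
def points : Set (Plane K) := {P | MvPolynomial.eval P.rep C.poly = 0}

/-- The homogeneous coordinate ring. -/
abbrev CoordRing : Type _ := MvPolynomial (Fin 3) K ⧸ Ideal.span {C.poly}

instance coordRing_isDomain : IsDomain C.CoordRing :=
  haveI : (Ideal.span {C.poly}).IsPrime :=
    (Ideal.span_singleton_prime C.irreducible.ne_zero).2 C.irreducible.prime
  Ideal.Quotient.isDomain _

/-- The class of a polynomial in the fraction field of the homogeneous coordinate ring. -/
def toFrac : MvPolynomial (Fin 3) K →ₐ[K] FractionRing C.CoordRing :=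
  (IsScalarTower.toAlgHom K C.CoordRing (FractionRing C.CoordRing)).comp
    (Ideal.Quotient.mkₐ K (Ideal.span {C.poly}))

/-- The function field `K(C)`: the fractions `f / g`, where `f` and `g` are forms of the same degree
and `g` does not vanish identically on the curve. -/
def functionField : IntermediateField K (FractionRing C.CoordRing) where
  carrier := {z | ∃ (n : ℕ) (f g : MvPolynomial (Fin 3) K), f.IsHomogeneous n ∧
    g.IsHomogeneous n ∧ C.toFrac g ≠ 0 ∧ z = C.toFrac f / C.toFrac g}
  mul_mem' := by
    rintro _ _ ⟨n, f, g, hf, hg, h0, rfl⟩ ⟨n', f', g', hf', hg', h0', rfl⟩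
    refine ⟨n + n', f * f', g * g', hf.mul hf', hg.mul hg', ?_, ?_⟩
    · rw [map_mul]; exact mul_ne_zero h0 h0'
    · rw [map_mul, map_mul, div_mul_div_comm]
  add_mem' := by
    rintro _ _ ⟨n, f, g, hf, hg, h0, rfl⟩ ⟨n', f', g', hf', hg', h0', rfl⟩
    refine ⟨n + n', f * g' + g * f', g * g', (hf.mul hg').add (hg.mul hf'), hg.mul hg', ?_, ?_⟩
    · rw [map_mul]; exact mul_ne_zero h0 h0'
    · rw [map_mul, map_add, map_mul, map_mul, div_add_div _ _ h0 h0']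
  algebraMap_mem' := by
    intro c
    refine ⟨0, MvPolynomial.C c, 1, MvPolynomial.isHomogeneous_C _ _,
      MvPolynomial.isHomogeneous_one _ _, by simp, ?_⟩
    rw [map_one, div_one]
    exact (C.toFrac.commutes c).symm
  inv_mem' := by
    rintro _ ⟨n, f, g, hf, hg, h0, rfl⟩
    by_cases h : C.toFrac f = 0
    · exact ⟨n, f, g, hf, hg, h0, by simp [h]⟩
    · exact ⟨n, g, f, hg, hf, h, by rw [inv_div]⟩

/-- The curve is rational: its function field is `K`-isomorphic to that of the projective line. -/
def IsRational : Prop := Nonempty (C.functionField ≃ₐ[K] RatFunc K)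

/-- The subfield `π_P^* K(ℙ¹)` of `K(C)` for the projection `π_P` from the point `P`. The projection
is given by two independent linear forms vanishing at `P`, so the field is generated by the
ratios of linear forms vanishing at `P`. -/
def projectionField (P : Plane K) : IntermediateField K C.functionField :=
  IntermediateField.adjoin K {z | ∃ l m : MvPolynomial (Fin 3) K,
    l.IsHomogeneous 1 ∧ m.IsHomogeneous 1 ∧
    MvPolynomial.eval P.rep l = 0 ∧ MvPolynomial.eval P.rep m = 0 ∧
    C.toFrac m ≠ 0 ∧ (z : FractionRing C.CoordRing) = C.toFrac l / C.toFrac m}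

/-- `P` is an inner Galois point: it lies on the curve, and the extension
`K(C) / π_P^* K(ℙ¹)` is Galois. -/
def IsInnerGalois (P : Plane K) : Prop :=
  P ∈ C.points ∧ IsGalois (C.projectionField P) C.functionField

/-- The differential of the defining form at (a representative of) `P`, as a linear form. -/
def differential (P : Plane K) : (Fin 3 → K) →ₗ[K] K :=
  ∑ i, MvPolynomial.eval P.rep (MvPolynomial.pderiv i C.poly) • LinearMap.proj i

/-- `P` is a smooth point of the curve. -/
def IsSmoothPoint (P : Plane K) : Prop := P ∈ C.points ∧ C.differential P ≠ 0

/-- The tangent line at a smooth point `P`, as a plane through the origin of `K³`. -/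
def tangentLine (P : Plane K) : Submodule K (Fin 3 → K) := LinearMap.ker (C.differential P)

/-- The restriction `F (v + T w)` of the defining form `F` to the line through the points with
representatives `v` and `w`; the point `v` is at the parameter `T = 0`. -/
def restrictToLine (v w : Fin 3 → K) : Polynomial K :=
  MvPolynomial.aeval (fun i => Polynomial.C (v i) + Polynomial.X * Polynomial.C (w i)) C.poly

/-- The intersection multiplicity `I_P(C, L)` of the curve and a line `L` through `P` (a plane in
`K³`): the order of vanishing at `P` of the defining form restricted to `L`, which is `⊤` if
the form vanishes on `L`. The line is parametrized by `P` and another point `w` of `L`; the order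
is the same for all `w`, so the infimum only removes this choice. -/
def intersectionMultiplicity (P : Plane K) (L : Submodule K (Fin 3 → K)) : ℕ∞ :=
  ⨅ w ∈ {w : Fin 3 → K | w ∈ L ∧ w ∉ P.submodule},
    emultiplicity Polynomial.X (C.restrictToLine P.rep w)

/-- `δ(C)`: the number of Galois points that are smooth points of the curve. -/
def delta : ℕ∞ := {P : Plane K | C.IsSmoothPoint P ∧ C.IsInnerGalois P}.encard

/-- `δ₂(C)`: the number of smooth Galois points `P` with `I_P(C, T_P C) = 4`. -/
def deltaTwo : ℕ∞ :=
  {P : Plane K | C.IsSmoothPoint P ∧ C.IsInnerGalois P ∧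
    C.intersectionMultiplicity P (C.tangentLine P) = 4}.encard

end PlaneCurve

/-- Two subsets of the plane are projectively equivalent: a projective linear transformation maps
one onto the other. -/
def ProjectivelyEquivalent {K : Type*} [Field K] (S T : Set (Plane K)) : Prop :=
  ∃ g : (Fin 3 → K) ≃ₗ[K] (Fin 3 → K),
    Projectivization.map (g : (Fin 3 → K) →ₗ[K] (Fin 3 → K)) g.injective '' S = T

/-- The forms `(s⁴, s(s+t)³, t⁴)`. -/
def quarticForms {K : Type*} [Field K] (v : Fin 2 → K) : Fin 3 → K :=
  ![v 0 ^ 4, v 0 * (v 0 + v 1) ^ 3, v 1 ^ 4]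

theorem quarticForms_ne_zero {K : Type*} [Field K] {v : Fin 2 → K} (hv : v ≠ 0) :
    quarticForms v ≠ 0 := by
  intro h
  have h0 : v 0 = 0 := by simpa [quarticForms] using congrFun h 0
  have h1 : v 1 = 0 := by simpa [quarticForms] using congrFun h 2
  exact hv (by ext i; fin_cases i <;> simp [h0, h1])

/-- The morphism `ℙ¹ → ℙ²`, `(s : t) ↦ (s⁴ : s(s+t)³ : t⁴)`. -/
def quarticMorphism (K : Type*) [Field K] : Line K → Plane K :=
  Projectivization.lift
    (fun v => Projectivization.mk K (quarticForms (v : Fin 2 → K)) (quarticForms_ne_zero v.2))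
    (by
      rintro ⟨a, ha⟩ ⟨b, hb⟩ c hab
      rw [Projectivization.mk_eq_mk_iff']
      refine ⟨c ^ 4, ?_⟩
      have hab' : a = c • b := hab
      subst hab'
      ext i
      fin_cases i <;> simp [quarticForms] <;> ring)

end GaloisPoint

end

/-!
Let `P`, `P'` be two smooth points at which the tangent lines have contact of order four. Neither
tangent line meets the quartic again. In coordinates in which `P = (0 : 0 : 1)`, `P' = (1 : 0 : 0)`
and the tangent lines are `x = 0` and `z = 0`, the equation is therefore
`κ y⁴ + x z Q(x, y, z) = 0` with `κ ≠ 0`, and the quadratic form `Q` vanishes at neither of the two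
points (`NormalForm`, `PlaneCurve.exists_normalForm_of_two_le_deltaTwo`).

If the curve is rational, then `z / x` is a fourth power `θ⁴` in the function field, since its zeros
and poles have multiplicities divisible by four. Moreover `y / x` has degree at most four over
`K(z / x)`, so that `θ` generates the function field, and `y / x` is integral over `K[θ]`. A
comparison of degrees gives the parametrization `(1 : W : X⁴)` with `W = w₁ X + w₂ X² + w₃ X³`
(`Param`, `exists_parametrization`).

The projection from `P` is `W : ℙ¹ → ℙ¹`. If the cubic extension `K(X) / K(W)` is Galois, then the
discriminant of `(W(Y) - W(X)) / (Y - X)`, as a polynomial in `Y`, is a square in `K[X]`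
(`exists_discrim_eq_sq_of_isGalois`), which means that `w₂² = 3 w₁ w₃`. Conversely, in this case
`W = k ((X + l)³ - l³)`, and completing the cube in `X` and in `1 / X` shows that the projections
from `P` and from `P'` are both Kummer extensions (`isGalois_of_cube_mem`). Rescaling the
coordinates and adding a multiple of `x` to `y` then takes the curve to `(s⁴ : s (s + t)³ : t⁴)`.

No other smooth point `(1 : W(r) : r⁴)` is a Galois point. The projection from it is the quotient of
`(X⁴ - r⁴) / (X - r)` and `(W - W(r)) / (X - r)`, which are coprime as the point is smooth
(`Param.eq_of_isSmoothPoint`), and the discriminant criterion gives a quartic polynomial in `X` that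
has to be a square. Its coefficients allow this only for the parameters `r` of the double points
(`Param.not_isInnerGalois`).

For the converse, a quartic projectively equivalent to the given curve is in normal form in the
obvious coordinates, by the orders of contact at the parameters `0` and `∞`. It has a
parametrization `(1 : W : X⁴)` as above, and it contains the points `(1 : u³ + 3 u² + 3 u : u⁴)`. So
`u³ + 3 u² + 3 u = W(ζ u)` with a fourth root of unity `ζ`, and `w₂² = 3 w₁ w₃` follows
(`Param.w₂_sq_of_form_eq_zero`).
-/

noncomputable section

namespace GaloisPoint

open Polynomial IntermediateField

/-! ### Galois subextensions of a rational function field -/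

/-- The degree of a rational function, from a representation as a quotient of coprime polynomials
whose denominator need not be monic. -/
theorem finrank_adjoin_div {K : Type*} [Field K] {N D : K[X]} (hND : IsCoprime N D) (hD : D ≠ 0) :
    Module.finrank K⟮(algebraMap K[X] (RatFunc K) N / algebraMap K[X] (RatFunc K) D)⟯ (RatFunc K) =
      max N.natDegree D.natDegree := by
  set h := algebraMap K[X] (RatFunc K) N / algebraMap K[X] (RatFunc K) D with hh
  have hD' : algebraMap K[X] (RatFunc K) D ≠ 0 := RatFunc.algebraMap_ne_zero hD
  have key : h.num * D = N * h.denom := by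
    apply RatFunc.algebraMap_injective K
    rw [map_mul, map_mul]
    have h1 := RatFunc.num_div_denom h
    rw [div_eq_iff (RatFunc.algebraMap_ne_zero h.denom_ne_zero)] at h1
    rw [h1, hh]
    field_simp
  have a1 : Associated h.num N := by
    apply associated_of_dvd_dvd
    · exact h.isCoprime_num_denom.dvd_of_dvd_mul_right (Dvd.intro _ key)
    · exact hND.dvd_of_dvd_mul_right (Dvd.intro _ key.symm)
  have a2 : Associated h.denom D := by
    apply associated_of_dvd_dvd
    · exact h.isCoprime_num_denom.symm.dvd_of_dvd_mul_left (Dvd.intro_left _ key.symm)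
    · exact hND.symm.dvd_of_dvd_mul_left (Dvd.intro_left _ key)
  rw [RatFunc.finrank_eq_max_natDegree,
    natDegree_eq_of_degree_eq (degree_eq_degree_of_associated a1),
    natDegree_eq_of_degree_eq (degree_eq_degree_of_associated a2)]

/-- If `K(X)` is a cubic Galois extension of `K(h)`, where `h = N / D`, then the two other roots of
`N(Y) - h D(Y)` lie in `K(X)` too, so that the discriminant of the quadratic polynomial in `Y`
vanishing at them is a square. This quadratic polynomial is the Bézoutian of `N` and `D`. -/
theorem exists_discrim_eq_sq_of_isGalois {K : Type*} [Field K] {N D B₀ B₁ B₂ : K[X]}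
    (hND : IsCoprime N D) (hD : D ≠ 0)
    (hdeg : max N.natDegree D.natDegree = 3)
    (hB : N.map C * C D - C N * D.map C =
      (X - C X : K[X][X]) * (C B₂ * X ^ 2 + C B₁ * X + C B₀)) (hB₂ : B₂ ≠ 0)
    (hG : IsGalois K⟮(algebraMap K[X] (RatFunc K) N / algebraMap K[X] (RatFunc K) D)⟯
      (RatFunc K)) :
    ∃ S : K[X], discrim B₂ B₁ B₀ = S ^ 2 := by
  set h := algebraMap K[X] (RatFunc K) N / algebraMap K[X] (RatFunc K) D with hh
  have hD' : algebraMap K[X] (RatFunc K) D ≠ 0 := RatFunc.algebraMap_ne_zero hD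
  have hfin := finrank_adjoin_div hND hD
  rw [hdeg, ← hh] at hfin
  have hint : IsIntegral K⟮h⟯ (RatFunc.X : RatFunc K) := Algebra.IsIntegral.isIntegral _
  have hμ : (minpoly K⟮h⟯ (RatFunc.X : RatFunc K)).natDegree = 3 := by
    rw [← hfin, ← (RatFunc.IntermediateField.adjoinXEquiv K⟮h⟯).toLinearEquiv.finrank_eq,
      adjoin.finrank hint]
  have hspl : ((minpoly K⟮h⟯ (RatFunc.X : RatFunc K)).map
      (algebraMap K⟮h⟯ (RatFunc K))).Splits := Normal.splits inferInstance _
  set q : K⟮h⟯[X] := N.map (algebraMap K K⟮h⟯) -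
    C (AdjoinSimple.gen K h) * D.map (algebraMap K K⟮h⟯) with hq
  -- the minimal polynomial of `X` is `q` up to a constant, and `q` is divisible by the Bézoutian
  have hqmap : C (algebraMap K[X] (RatFunc K) D) * q.map (algebraMap K⟮h⟯ (RatFunc K)) =
      (X - C RatFunc.X) * (C (algebraMap K[X] (RatFunc K) B₂) * X ^ 2 +
        C (algebraMap K[X] (RatFunc K) B₁) * X + C (algebraMap K[X] (RatFunc K) B₀)) := by
    have h1 := congrArg (Polynomial.map (algebraMap K[X] (RatFunc K))) hB
    simp only [Polynomial.map_sub, Polynomial.map_mul, Polynomial.map_add, Polynomial.map_pow,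
      Polynomial.map_X, Polynomial.map_C, Polynomial.map_map, RatFunc.algebraMap_X] at h1
    rw [← h1, hq]
    simp only [Polynomial.map_sub, Polynomial.map_mul, Polynomial.map_C, Polynomial.map_map,
      AdjoinSimple.algebraMap_gen, mul_sub, ← mul_assoc, ← C_mul]
    rw [hh, mul_div_cancel₀ _ hD']
    rw [mul_comm (C _)]
    rfl
  have hB₂' : algebraMap K[X] (RatFunc K) B₂ ≠ 0 := RatFunc.algebraMap_ne_zero hB₂
  set b : (RatFunc K)[X] := C (algebraMap K[X] (RatFunc K) B₂) * X ^ 2 +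
        C (algebraMap K[X] (RatFunc K) B₁) * X + C (algebraMap K[X] (RatFunc K) B₀) with hb
  have hbdeg : b.degree = 2 := degree_quadratic hB₂'
  have hb0 : b ≠ 0 := by rintro h0; rw [h0] at hbdeg; simp at hbdeg
  have hq0 : q ≠ 0 := by
    rintro h0
    rw [h0, Polynomial.map_zero, mul_zero] at hqmap
    exact mul_ne_zero (X_sub_C_ne_zero _) hb0 hqmap.symm
  have hdvd : minpoly K⟮h⟯ (RatFunc.X : RatFunc K) ∣ q := by
    apply minpoly.dvd
    have h1 := congrArg (Polynomial.eval RatFunc.X) hqmap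
    rw [eval_mul, eval_mul, eval_C, eval_sub, eval_X, eval_C, sub_self, zero_mul] at h1
    rw [aeval_def, ← eval_map]
    exact (mul_eq_zero.1 h1).resolve_left hD'
  have hqdeg : q.natDegree ≤ 3 := by
    rw [hq]
    refine (natDegree_sub_le _ _).trans (max_le ?_ ?_)
    · exact natDegree_map_le.trans (hdeg ▸ le_max_left _ _)
    · exact (natDegree_C_mul_le _ _).trans (natDegree_map_le.trans (hdeg ▸ le_max_right _ _))
  have hqspl : (q.map (algebraMap K⟮h⟯ (RatFunc K))).Splits := by
    have h1 : Associated (minpoly K⟮h⟯ (RatFunc.X : RatFunc K)) q :=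
      associated_of_dvd_of_natDegree_le hdvd hq0 (hqdeg.trans hμ.ge)
    obtain ⟨u, hu⟩ := h1
    rw [← hu, Polynomial.map_mul]
    refine hspl.mul ?_
    apply Polynomial.Splits.of_degree_le_one
    obtain ⟨r, -, hr⟩ := Polynomial.isUnit_iff.1 u.isUnit
    rw [← hr, Polynomial.map_C]
    exact degree_C_le.trans (by norm_num)
  have hbspl : b.Splits := by
    refine Polynomial.Splits.of_dvd ((Polynomial.Splits.C (algebraMap K[X] (RatFunc K) D)).mul
      hqspl) ?_ (hqmap ▸ dvd_mul_left _ _)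
    rw [hqmap]
    exact mul_ne_zero (X_sub_C_ne_zero _) hb0
  obtain ⟨ρ, hρ⟩ := hbspl.exists_eval_eq_zero (by rw [hbdeg]; norm_num)
  have hρ' : algebraMap K[X] (RatFunc K) (discrim B₂ B₁ B₀) =
      (2 * algebraMap K[X] (RatFunc K) B₂ * ρ + algebraMap K[X] (RatFunc K) B₁) ^ 2 := by
    simp only [hb, eval_add, eval_mul, eval_C, eval_pow, eval_X] at hρ
    simp only [discrim, map_sub, map_mul, map_pow, map_ofNat]
    linear_combination (-4 * algebraMap K[X] (RatFunc K) B₂) * hρ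
  obtain ⟨S, hS⟩ := IsIntegrallyClosed.exists_algebraMap_eq_of_isIntegral_pow (R := K[X])
    (K := RatFunc K) (n := 2) (by norm_num) (hρ' ▸ isIntegral_algebraMap)
  refine ⟨S, RatFunc.algebraMap_injective K ?_⟩
  rw [hρ', map_pow, hS]

/-- A Kummer extension: adjoining a cube root to a field with primitive cube roots of unity. -/
theorem isGalois_of_cube_mem {K M : Type*} [Field K] [IsAlgClosed K] [Field M]
    [Algebra K M] (h3 : (3 : K) ≠ 0) (L : IntermediateField K M) {y : M} (hy0 : y ≠ 0)
    (hy : y ^ 3 ∈ L) (htop : K⟮y⟯ = ⊤) : IsGalois L M := by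
  have : NeZero ((3 : ℕ) : K) := ⟨by exact_mod_cast h3⟩
  obtain ⟨ω, hω⟩ := HasEnoughRootsOfUnity.exists_primitiveRoot K 3
  set a : L := ⟨y ^ 3, hy⟩ with ha
  have ha' : algebraMap L M a = y ^ 3 := rfl
  have hint : IsIntegral L y := by
    refine IsIntegral.of_pow (n := 3) (by norm_num) ?_
    rw [← ha']
    exact isIntegral_algebraMap
  have hsplit : IsSplittingField L M (X ^ 3 - C a) := by
    refine ⟨?_, ?_⟩
    · rw [Polynomial.map_sub, Polynomial.map_pow, Polynomial.map_X, Polynomial.map_C, ha']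
      exact X_pow_sub_C_splits_of_isPrimitiveRoot
        (hω.map_of_injective (algebraMap K M).injective) rfl
    · rw [_root_.eq_top_iff]
      have h1 : Algebra.adjoin L {y} = ⊤ := by
        rw [← adjoin_simple_toSubalgebra_of_isAlgebraic hint.isAlgebraic,
          ← top_toSubalgebra, toSubalgebra_inj, ← restrictScalars_eq_top_iff (K := K),
          restrictScalars_adjoin, _root_.eq_top_iff, ← htop]
        exact adjoin.mono _ _ _ (by simp)
      rw [← h1]
      apply Algebra.adjoin_mono
      rw [Set.singleton_subset_iff, mem_rootSet']
      refine ⟨?_, by simp [ha']⟩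
      rw [Polynomial.map_sub, Polynomial.map_pow, Polynomial.map_X, Polynomial.map_C]
      exact X_pow_sub_C_ne_zero (by norm_num) _
  refine IsGalois.of_separable_splitting_field (p := X ^ 3 - C a) ?_
  refine separable_X_pow_sub_C _ ?_ ?_
  · have : ((3 : ℕ) : L) = algebraMap K L 3 := (map_natCast (algebraMap K L) 3).symm
    rw [this]
    exact (_root_.map_ne_zero _).2 h3
  · intro h0
    rw [h0, map_zero] at ha'
    exact pow_ne_zero 3 hy0 ha'.symm

theorem isGalois_adjoin_simple_map {K M N : Type*} [Field K] [Field M]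
    [Field N] [Algebra K M] [Algebra K N] (ψ : M ≃ₐ[K] N) (h : M) (hG : IsGalois K⟮h⟯ M) :
    IsGalois K⟮ψ h⟯ N := by
  have e : K⟮h⟯.map (ψ : M →ₐ[K] N) = K⟮ψ h⟯ := by
    rw [adjoin_map, Set.image_singleton]; rfl
  refine IsGalois.of_equiv_equiv (F := K⟮h⟯) (E := M)
    (f := ((intermediateFieldMap ψ K⟮h⟯).trans (equivOfEq e)).toRingEquiv)
    (g := ψ.toRingEquiv) ?_
  ext x
  rfl

theorem isGalois_adjoin_simple_map_iff {K M N : Type*} [Field K] [Field M]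
    [Field N] [Algebra K M] [Algebra K N] (ψ : M ≃ₐ[K] N) (h : M) :
    IsGalois K⟮ψ h⟯ N ↔ IsGalois K⟮h⟯ M := by
  refine ⟨fun H => ?_, isGalois_adjoin_simple_map ψ h⟩
  have := isGalois_adjoin_simple_map ψ.symm (ψ h) H
  rwa [AlgEquiv.symm_apply_apply] at this

/-! ### Rational solutions of the normal form -/

variable {K : Type*} [Field K]

/-- Finitely generated ideals of `K[X]` being principal, three polynomials can be divided by their
greatest common divisor. -/
theorem exists_coprime_triple {d n₁ n₂ : K[X]} (hd : d ≠ 0) :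
    ∃ G d' n₁' n₂' u v w : K[X], G ≠ 0 ∧ d = G * d' ∧ n₁ = G * n₁' ∧ n₂ = G * n₂' ∧
      u * d' + v * n₁' + w * n₂' = 1 := by
  have hP := (IsPrincipalIdealRing.principal (Ideal.span {d, n₁, n₂} : Ideal K[X])).principal
  obtain ⟨G, hG⟩ := hP
  change Ideal.span {d, n₁, n₂} = Ideal.span {G} at hG
  have hmem : ∀ x ∈ ({d, n₁, n₂} : Set K[X]), G ∣ x := fun x hx => by
    rw [← Ideal.mem_span_singleton, ← hG]
    exact Ideal.subset_span hx
  obtain ⟨d', rfl⟩ := hmem d (by simp)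
  obtain ⟨n₁', rfl⟩ := hmem n₁ (by simp)
  obtain ⟨n₂', rfl⟩ := hmem n₂ (by simp)
  have hG0 : G ≠ 0 := left_ne_zero_of_mul hd
  have h1 : G ∈ Ideal.span {G * d', G * n₁', G * n₂'} := by
    rw [hG]; exact Ideal.mem_span_singleton_self G
  obtain ⟨u, z, hz, h2⟩ := Ideal.mem_span_insert.1 h1
  obtain ⟨v, w, h3⟩ := Ideal.mem_span_pair.1 hz
  refine ⟨G, d', n₁', n₂', u, v, w, hG0, rfl, rfl, rfl, ?_⟩
  apply mul_left_cancel₀ hG0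
  rw [mul_one]
  linear_combination -h2 + h3

/-- A coprime factor of a fourth power in `K[X]` is a fourth power: the units are constants, and
these are fourth powers since `K` is algebraically closed. -/
theorem exists_eq_pow_four [IsAlgClosed K] {p q r : K[X]} (hpq : IsCoprime p q)
    (h : p * q = r ^ 4) : ∃ s, p = s ^ 4 := by
  obtain ⟨d, u, hu⟩ := exists_associated_pow_of_mul_eq_pow' hpq h
  obtain ⟨κ, -, hκ⟩ := Polynomial.isUnit_iff.1 u.isUnit
  obtain ⟨l, hl⟩ := IsAlgClosed.exists_pow_nat_eq κ (n := 4) (by norm_num)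
  refine ⟨d * C l, ?_⟩
  rw [← hu, ← hκ, mul_pow, ← C_pow, hl]

/-- On a quartic `c y⁴ + x z Q(x, y, z) = 0` parametrized by rational functions, with `Q` nonzero at
`(1 : 0 : 0)` and `(0 : 0 : 1)`, the function `z / x` is a fourth power: the lines `x = 0` and
`z = 0` meet the curve in one point each, with multiplicity four. -/
theorem exists_pow_four_eq [IsAlgClosed K] {f g : RatFunc K} {c α β γ δ ε ζ : K} (hc : c ≠ 0)
    (hγ : γ ≠ 0) (hα : α ≠ 0)
    (rel : RatFunc.C c * f ^ 4 + g * (RatFunc.C α + RatFunc.C β * g + RatFunc.C γ * g ^ 2 +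
      RatFunc.C δ * f + RatFunc.C ε * f * g + RatFunc.C ζ * f ^ 2) = 0) :
    ∃ θ : RatFunc K, θ ^ 4 = g := by
  obtain ⟨G, d, n₁, n₂, u, v, w, hG, hd, hn₁, hn₂, huv⟩ := exists_coprime_triple
    (d := f.denom * g.denom) (n₁ := f.num * g.denom) (n₂ := g.num * f.denom)
    (mul_ne_zero f.denom_ne_zero g.denom_ne_zero)
  have hd0 : d ≠ 0 := by
    rintro rfl
    rw [mul_zero] at hd
    exact mul_ne_zero f.denom_ne_zero g.denom_ne_zero hd
  have hd0' : algebraMap K[X] (RatFunc K) d ≠ 0 := RatFunc.algebraMap_ne_zero hd0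
  have hG' : algebraMap K[X] (RatFunc K) G ≠ 0 := RatFunc.algebraMap_ne_zero hG
  have hfd : algebraMap K[X] (RatFunc K) f.denom ≠ 0 :=
    RatFunc.algebraMap_ne_zero f.denom_ne_zero
  have hgd : algebraMap K[X] (RatFunc K) g.denom ≠ 0 :=
    RatFunc.algebraMap_ne_zero g.denom_ne_zero
  have hd' := congrArg (algebraMap K[X] (RatFunc K)) hd
  have hn₁' := congrArg (algebraMap K[X] (RatFunc K)) hn₁
  have hn₂' := congrArg (algebraMap K[X] (RatFunc K)) hn₂
  simp only [map_mul] at hd' hn₁' hn₂'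
  have hf : f = algebraMap K[X] (RatFunc K) n₁ / algebraMap K[X] (RatFunc K) d := by
    rw [eq_div_iff hd0']
    apply mul_left_cancel₀ hG'
    rw [← hn₁', mul_left_comm, ← hd']
    nth_rw 1 [← RatFunc.num_div_denom f]
    field_simp
  have hg : g = algebraMap K[X] (RatFunc K) n₂ / algebraMap K[X] (RatFunc K) d := by
    rw [eq_div_iff hd0']
    apply mul_left_cancel₀ hG'
    rw [← hn₂', mul_left_comm, ← hd']
    nth_rw 1 [← RatFunc.num_div_denom g]
    field_simp
  set Q : K[X] := C α * d ^ 2 + C β * d * n₂ + C γ * n₂ ^ 2 + C δ * d * n₁ + C ε * n₁ * n₂ +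
    C ζ * n₁ ^ 2 with hQ
  have hrel : C c * n₁ ^ 4 + d * n₂ * Q = 0 := by
    apply RatFunc.algebraMap_injective K
    rw [hf, hg] at rel
    simp only [hQ, map_add, map_mul, map_pow, RatFunc.algebraMap_C, map_zero]
    field_simp at rel
    linear_combination rel
  have hcu : C c * C c⁻¹ = 1 := by rw [← C_mul, mul_inv_cancel₀ hc, C_1]
  have hprod : d * (n₂ * (-C c⁻¹ * Q)) = n₁ ^ 4 := by
    linear_combination (-C c⁻¹) * hrel + n₁ ^ 4 * hcu
  have hunit : IsUnit (-C c⁻¹ : K[X]) := (Polynomial.isUnit_C.2 (inv_ne_zero hc).isUnit).neg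
  -- a prime factor common to two of `d`, `n₂`, `Q` divides `n₁` by the equation, and then all three
  have hn₁dvd : ∀ π : K[X], Prime π → π ∣ n₁ ^ 4 → π ∣ n₁ := fun π hπ h => hπ.dvd_of_dvd_pow h
  have hnot : ∀ π : K[X], Prime π → π ∣ d → π ∣ n₁ → π ∣ n₂ → False := by
    intro π hπ h1 h2 h3
    apply hπ.not_isUnit
    rw [isUnit_iff_dvd_one, ← huv]
    exact dvd_add (dvd_add (h1.mul_left _) (h2.mul_left _)) (h3.mul_left _)
  have hdn₂ : ∀ π : K[X], Prime π → π ∣ d → π ∣ n₂ → False := by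
    intro π hπ h1 h2
    refine hnot π hπ h1 (hn₁dvd π hπ ?_) h2
    rw [← hprod]
    exact h1.mul_right _
  have hsq : ∀ (π m : K[X]) (κ : K), κ ≠ 0 → Prime π → π ∣ C κ * m ^ 2 → π ∣ m := by
    intro π m κ hκ hπ h1
    refine hπ.dvd_of_dvd_pow (((Polynomial.isUnit_C.2 hκ.isUnit).dvd_mul_left).1 h1)
  have hdQ : ∀ π : K[X], Prime π → π ∣ d → π ∣ Q → False := by
    intro π hπ h1 h2
    have h3 : π ∣ n₁ := hn₁dvd π hπ (hprod ▸ h1.mul_right _)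
    refine hdn₂ π hπ h1 (hsq π n₂ γ hγ hπ ?_)
    have : C γ * n₂ ^ 2 = Q - d * (C α * d + C β * n₂ + C δ * n₁) -
      n₁ * (C ε * n₂ + C ζ * n₁) := by rw [hQ]; ring
    rw [this]
    exact dvd_sub (dvd_sub h2 (h1.mul_right _)) (h3.mul_right _)
  have hn₂Q : ∀ π : K[X], Prime π → π ∣ n₂ → π ∣ Q → False := by
    intro π hπ h1 h2
    have h3 : π ∣ n₁ := hn₁dvd π hπ (hprod ▸ (h1.mul_right _).mul_left _)
    refine hdn₂ π hπ (hsq π d α hα hπ ?_) h1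
    have : C α * d ^ 2 = Q - n₂ * (C β * d + C γ * n₂ + C ε * n₁) -
      n₁ * (C δ * d + C ζ * n₁) := by rw [hQ]; ring
    rw [this]
    exact dvd_sub (dvd_sub h2 (h1.mul_right _)) (h3.mul_right _)
  have hcop1 : IsCoprime d (n₂ * (-C c⁻¹ * Q)) := by
    refine isCoprime_of_prime_dvd (fun h => hd0 h.1) fun π hπ h1 h2 => ?_
    rcases hπ.dvd_or_dvd h2 with h3 | h3
    · exact hdn₂ π hπ h1 h3
    · exact hdQ π hπ h1 (hunit.dvd_mul_left.1 h3)
  obtain ⟨A, hA⟩ := exists_eq_pow_four hcop1 hprod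
  by_cases hn₂0 : n₂ = 0
  · exact ⟨0, by rw [hg, hn₂0]; simp⟩
  have hcop2 : IsCoprime n₂ (d * (-C c⁻¹ * Q)) := by
    refine isCoprime_of_prime_dvd (fun h => hn₂0 h.1) fun π hπ h1 h2 => ?_
    rcases hπ.dvd_or_dvd h2 with h3 | h3
    · exact hdn₂ π hπ h3 h1
    · exact hn₂Q π hπ h1 (hunit.dvd_mul_left.1 h3)
  obtain ⟨B, hB⟩ := exists_eq_pow_four hcop2 (by rw [← hprod]; ring)
  exact ⟨algebraMap K[X] (RatFunc K) B / algebraMap K[X] (RatFunc K) A, by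
    rw [hg, hA, hB, div_pow, map_pow, map_pow]⟩

/-- If `g = θ⁴` and `f` is a root of a quartic polynomial over `K(g)`, and `K(X) = K(f, g)`, then
`[K(X) : K(g)] ≤ 4 = [K(θ) : K(g)]`, so that `K(X) = K(θ)`. -/
theorem adjoin_simple_eq_top_of_pow_four {f θ : RatFunc K} {c α β γ δ ε ζ : K} (hc : c ≠ 0)
    (htop : IntermediateField.adjoin K {f, θ ^ 4} = ⊤)
    (rel : RatFunc.C c * f ^ 4 + θ ^ 4 * (RatFunc.C α + RatFunc.C β * θ ^ 4 +
      RatFunc.C γ * (θ ^ 4) ^ 2 + RatFunc.C δ * f + RatFunc.C ε * f * θ ^ 4 +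
      RatFunc.C ζ * f ^ 2) = 0) :
    K⟮θ⟯ = ⊤ := by
  have hfin1 : Module.finrank K⟮θ⟯ (RatFunc K) = max θ.num.natDegree θ.denom.natDegree :=
    RatFunc.finrank_eq_max_natDegree θ
  have hfin4 : Module.finrank K⟮θ ^ 4⟯ (RatFunc K) = 4 * max θ.num.natDegree θ.denom.natDegree := by
    have h1 := finrank_adjoin_div (N := θ.num ^ 4) (D := θ.denom ^ 4)
      θ.isCoprime_num_denom.pow (pow_ne_zero _ θ.denom_ne_zero)
    rw [map_pow, map_pow, ← div_pow, RatFunc.num_div_denom, natDegree_pow, natDegree_pow] at h1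
    rw [h1]
    omega
  set G : K⟮θ ^ 4⟯ := AdjoinSimple.gen K (θ ^ 4) with hG
  have hGm : algebraMap K⟮θ ^ 4⟯ (RatFunc K) G = θ ^ 4 := rfl
  let k : K → K⟮θ ^ 4⟯ := algebraMap K K⟮θ ^ 4⟯
  have hk : ∀ x, algebraMap K⟮θ ^ 4⟯ (RatFunc K) (k x) = RatFunc.C x := fun x => rfl
  have hkc : k c ≠ 0 := (_root_.map_ne_zero _).2 hc
  set q : K⟮θ ^ 4⟯[X] := C (k c) * X ^ 4 + (C (G * k ζ) * X ^ 2 + C (G * (k δ + k ε * G)) * X +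
    C (G * (k α + k β * G + k γ * G ^ 2))) with hq
  have hqd : q.natDegree = 4 := by
    rw [hq]
    compute_degree!
  have hq0 : q ≠ 0 := by rintro h0; rw [h0] at hqd; simp at hqd
  have hqf : aeval f q = 0 := by
    simp only [hq, map_add, map_mul, map_pow, aeval_C, aeval_X, hGm, hk]
    linear_combination rel
  have halg : IsAlgebraic K⟮θ ^ 4⟯ f := ⟨q, hq0, hqf⟩
  have htop' : K⟮θ ^ 4⟯⟮f⟯ = ⊤ := by
    rw [← restrictScalars_eq_top_iff (K := K), ← htop, adjoin_simple_adjoin_simple, Set.pair_comm]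
  have hle : Module.finrank K⟮θ ^ 4⟯ (RatFunc K) ≤ 4 ∧
      0 < Module.finrank K⟮θ ^ 4⟯ (RatFunc K) := by
    have e1 : Module.finrank K⟮θ ^ 4⟯ K⟮θ ^ 4⟯⟮f⟯ = Module.finrank K⟮θ ^ 4⟯ (RatFunc K) := by
      rw [htop']; exact finrank_top'
    rw [← e1, adjoin.finrank halg.isIntegral]
    refine ⟨?_, minpoly.natDegree_pos halg.isIntegral⟩
    exact (natDegree_le_of_dvd (minpoly.dvd _ _ hqf) hq0).trans hqd.le
  rw [← finrank_eq_one_iff_eq_top, hfin1]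
  omega

theorem exists_algEquiv_X {θ : RatFunc K} (hθ : K⟮θ⟯ = ⊤) :
    ∃ σ : RatFunc K ≃ₐ[K] RatFunc K, σ θ = RatFunc.X := by
  have ht : Transcendental K θ := by
    apply RatFunc.transcendental_of_ne_C
    rintro ⟨κ, rfl⟩
    have := RatFunc.finrank_eq_max_natDegree (RatFunc.C κ)
    rw [hθ, IntermediateField.finrank_top] at this
    simp at this
  let e : RatFunc K ≃ₐ[K] RatFunc K :=
    (RatFunc.algEquivOfTranscendental θ ht).trans ((equivOfEq hθ).trans topEquiv)
  refine ⟨e.symm, ?_⟩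
  rw [AlgEquiv.symm_apply_eq]
  exact (RatFunc.algEquivOfTranscendental_X θ ht).symm

/-- A rational function `f` with `c f⁴ + X⁴ Q(1, f, X⁴) = 0` is integral over `K[X]`, hence a
polynomial, and a comparison of degrees and of the coefficients of `X⁴` and `X¹²` determines its
shape. -/
theorem exists_eq_cubic {f : RatFunc K} {c α β γ δ ε ζ : K} (hc : c ≠ 0)
    (hγ : γ ≠ 0) (hα : α ≠ 0)
    (rel : RatFunc.C c * f ^ 4 + RatFunc.X ^ 4 * (RatFunc.C α + RatFunc.C β * RatFunc.X ^ 4 +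
      RatFunc.C γ * (RatFunc.X ^ 4) ^ 2 + RatFunc.C δ * f + RatFunc.C ε * f * RatFunc.X ^ 4 +
      RatFunc.C ζ * f ^ 2) = 0) :
    ∃ w₁ w₂ w₃ : K, w₁ ≠ 0 ∧ w₃ ≠ 0 ∧
      f = algebraMap K[X] (RatFunc K) (C w₁ * X + C w₂ * X ^ 2 + C w₃ * X ^ 3) := by
  have hcu : RatFunc.C c * RatFunc.C c⁻¹ = 1 := by rw [← map_mul, mul_inv_cancel₀ hc, map_one]
  have hint : IsIntegral K[X] f := by
    refine ⟨X ^ 4 + (C (C c⁻¹ * X ^ 4 * C ζ) * X ^ 2 + C (C c⁻¹ * X ^ 4 * (C δ + C ε * X ^ 4)) * X +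
      C (C c⁻¹ * X ^ 4 * (C α + C β * X ^ 4 + C γ * X ^ 8))), ?_, ?_⟩
    · monicity!
    · simp only [eval₂_add, eval₂_mul, eval₂_C, eval₂_X, eval₂_pow, map_add, map_mul, map_pow,
        RatFunc.algebraMap_C, RatFunc.algebraMap_X]
      linear_combination RatFunc.C c⁻¹ * rel - f ^ 4 * hcu
  obtain ⟨W, rfl⟩ := IsIntegrallyClosed.isIntegral_iff.1 hint
  have hW : C c * W ^ 4 + X ^ 4 * (C α + C β * X ^ 4 + C γ * X ^ 8 + C δ * W + C ε * W * X ^ 4 +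
      C ζ * W ^ 2) = 0 := by
    apply RatFunc.algebraMap_injective K
    simp only [map_add, map_mul, map_pow, RatFunc.algebraMap_C, RatFunc.algebraMap_X, map_zero]
    linear_combination rel
  have hdeg : W.natDegree ≤ 3 := by
    by_contra! hlt
    have h1 : (C c * W ^ 4).natDegree = 4 * W.natDegree := by
      rw [natDegree_C_mul hc, natDegree_pow]
    have h2 : C c * W ^ 4 = -(X ^ 4 * (C α + C β * X ^ 4 + C γ * X ^ 8 + C δ * W +
      C ε * W * X ^ 4 + C ζ * W ^ 2)) := eq_neg_of_add_eq_zero_left hW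
    rw [h2, natDegree_neg] at h1
    have h3 : (X ^ 4 * (C α + C β * X ^ 4 + C γ * X ^ 8 + C δ * W +
      C ε * W * X ^ 4 + C ζ * W ^ 2)).natDegree ≤ 4 * W.natDegree - 1 := by
      refine natDegree_mul_le.trans ?_
      rw [natDegree_X_pow]
      have : (C α + C β * X ^ 4 + C γ * X ^ 8 + C δ * W +
        C ε * W * X ^ 4 + C ζ * W ^ 2).natDegree ≤ 4 * W.natDegree - 5 := by
        refine natDegree_add_le_of_degree_le (natDegree_add_le_of_degree_le
          (natDegree_add_le_of_degree_le (natDegree_add_le_of_degree_le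
          (natDegree_add_le_of_degree_le ?_ ?_) ?_) ?_) ?_) ?_
        · rw [natDegree_C]; omega
        · exact (natDegree_C_mul_X_pow_le _ _).trans (by omega)
        · exact (natDegree_C_mul_X_pow_le _ _).trans (by omega)
        · exact (natDegree_C_mul_le _ _).trans (by omega)
        · refine (natDegree_mul_le.trans (add_le_add (natDegree_C_mul_le _ _)
            (natDegree_X_pow _).le)).trans (by omega)
        · refine (natDegree_C_mul_le _ _).trans ?_
          rw [natDegree_pow]; omega
      omega
    omega
  obtain ⟨w₀, w₁, w₂, w₃, rfl⟩ : ∃ w₀ w₁ w₂ w₃ : K,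
      W = C w₀ + C w₁ * X + C w₂ * X ^ 2 + C w₃ * X ^ 3 := by
    refine ⟨W.coeff 0, W.coeff 1, W.coeff 2, W.coeff 3, ?_⟩
    conv_lhs => rw [W.as_sum_range_C_mul_X_pow' (Nat.lt_succ_of_le hdeg)]
    simp [Finset.sum_range_succ]
  have hw₀ : w₀ = 0 := by
    have := congrArg (Polynomial.eval 0) hW
    simpa [hc] using this
  subst hw₀
  set V : K[X] := C w₁ + C w₂ * X + C w₃ * X ^ 2 with hV
  have hV' : C c * V ^ 4 + (C α + C β * X ^ 4 + C γ * X ^ 8 + C δ * (X * V) +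
      C ε * (X ^ 5 * V) + C ζ * (X ^ 2 * V ^ 2)) = 0 := by
    apply mul_left_cancel₀ (pow_ne_zero 4 X_ne_zero)
    rw [mul_zero, ← hW, hV, C_0]
    ring
  refine ⟨w₁, w₂, w₃, ?_, ?_, by rw [C_0, zero_add]⟩
  · rintro rfl
    have := congrArg (Polynomial.eval 0) hV'
    simp [hV, hα] at this
  · rintro rfl
    have hVd : V.natDegree ≤ 1 := by rw [hV, C_0, zero_mul, add_zero]; compute_degree!
    have h8 := congrArg (fun p => Polynomial.coeff p 8) hV'
    have e1 : (V ^ 4).coeff 8 = 0 :=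
      coeff_eq_zero_of_natDegree_lt (by rw [natDegree_pow]; omega)
    have e2 : (X * V).coeff 8 = 0 := by
      rw [coeff_X_mul]
      exact coeff_eq_zero_of_natDegree_lt (by omega)
    have e3 : (X ^ 5 * V).coeff 8 = 0 := by
      rw [show (8 : ℕ) = 3 + 5 from rfl, coeff_X_pow_mul]
      exact coeff_eq_zero_of_natDegree_lt (by omega)
    have e4 : (X ^ 2 * V ^ 2).coeff 8 = 0 := by
      rw [show (8 : ℕ) = 6 + 2 from rfl, coeff_X_pow_mul]
      exact coeff_eq_zero_of_natDegree_lt (by rw [natDegree_pow]; omega)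
    simp [coeff_X_pow, e1, e2, e3, e4, hγ] at h8

/-- A field `K(f, g)`, isomorphic to `K(X)`, in which `f = y / x` and `g = z / x` satisfy the
equation of a quartic `c y⁴ + x z Q(x, y, z)` with `Q` nonzero at `(1 : 0 : 0)` and `(0 : 0 : 1)`:
in a suitable parameter, `g` is the fourth power of the parameter and `f` a cubic polynomial
in it. -/
theorem exists_parametrization [IsAlgClosed K] {M : Type*} [Field M] [Algebra K M]
    (ψ₀ : M ≃ₐ[K] RatFunc K) {f g : M} (htop : IntermediateField.adjoin K {f, g} = ⊤)
    {c α β γ δ ε ζ : K} (hc : c ≠ 0) (hγ : γ ≠ 0) (hα : α ≠ 0)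
    (rel : algebraMap K M c * f ^ 4 + g * (algebraMap K M α + algebraMap K M β * g +
      algebraMap K M γ * g ^ 2 + algebraMap K M δ * f + algebraMap K M ε * f * g +
      algebraMap K M ζ * f ^ 2) = 0) :
    ∃ (ψ : M ≃ₐ[K] RatFunc K) (w₁ w₂ w₃ : K), w₁ ≠ 0 ∧ w₃ ≠ 0 ∧ ψ g = RatFunc.X ^ 4 ∧
      ψ f = algebraMap K[X] (RatFunc K) (C w₁ * X + C w₂ * X ^ 2 + C w₃ * X ^ 3) := by
  have rel' : ∀ ψ : M ≃ₐ[K] RatFunc K, RatFunc.C c * ψ f ^ 4 + ψ g * (RatFunc.C α +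
      RatFunc.C β * ψ g + RatFunc.C γ * ψ g ^ 2 + RatFunc.C δ * ψ f + RatFunc.C ε * ψ f * ψ g +
      RatFunc.C ζ * ψ f ^ 2) = 0 := by
    intro ψ
    have h1 := congrArg ψ rel
    simp only [map_add, map_mul, map_pow, AlgEquiv.commutes, map_zero] at h1
    exact h1
  obtain ⟨θ, hθ⟩ := exists_pow_four_eq hc hγ hα (rel' ψ₀)
  have htop' : IntermediateField.adjoin K {ψ₀ f, θ ^ 4} = ⊤ := by
    have h1 := congrArg (IntermediateField.map (ψ₀ : M →ₐ[K] RatFunc K)) htop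
    rw [adjoin_map, Set.image_pair] at h1
    rw [hθ]
    refine h1.trans ?_
    rw [← AlgHom.fieldRange_eq_map]
    exact AlgHom.fieldRange_eq_top.2 ψ₀.surjective
  have hθtop := adjoin_simple_eq_top_of_pow_four hc htop' (by rw [hθ]; exact rel' ψ₀)
  obtain ⟨σ, hσ⟩ := exists_algEquiv_X hθtop
  have hg : (ψ₀.trans σ) g = RatFunc.X ^ 4 := by
    rw [AlgEquiv.trans_apply, ← hθ, map_pow, hσ]
  have rel'' := rel' (ψ₀.trans σ)
  rw [hg] at rel''
  obtain ⟨w₁, w₂, w₃, hw₁, hw₃, hf⟩ := exists_eq_cubic hc hγ hα rel''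
  exact ⟨ψ₀.trans σ, w₁, w₂, w₃, hw₁, hw₃, hg, hf⟩

/-! ### Linear forms, coordinates and the projection field -/

/-- The linear form with the given coefficients. -/
def linForm (a : Fin 3 → K) : MvPolynomial (Fin 3) K :=
  ∑ i, MvPolynomial.C (a i) * MvPolynomial.X i

theorem linForm_isHomogeneous (a : Fin 3 → K) : (linForm a).IsHomogeneous 1 :=
  MvPolynomial.IsHomogeneous.sum _ _ _ fun i _ => by
    simpa using (MvPolynomial.isHomogeneous_C (Fin 3) (a i)).mul (MvPolynomial.isHomogeneous_X K i)

theorem aeval_linForm {A : Type*} [CommRing A] [Algebra K A] (v : Fin 3 → A) (a : Fin 3 → K) :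
    MvPolynomial.aeval v (linForm a) = ∑ i, algebraMap K A (a i) * v i := by
  simp [linForm]

/-- The `i`-th coordinate with respect to the basis `b`, as a linear form. -/
def coordForm (b : Module.Basis (Fin 3) K (Fin 3 → K)) (i : Fin 3) : MvPolynomial (Fin 3) K :=
  linForm fun j => b.repr (Pi.single j 1) i

theorem coordForm_isHomogeneous (b : Module.Basis (Fin 3) K (Fin 3 → K)) (i : Fin 3) :
    (coordForm b i).IsHomogeneous 1 := linForm_isHomogeneous _

theorem repr_eq_sum (b : Module.Basis (Fin 3) K (Fin 3 → K)) (v : Fin 3 → K) (i : Fin 3) :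
    b.repr v i = ∑ j, b.repr (Pi.single j 1) i * v j := by
  have h := LinearMap.pi_apply_eq_sum_univ (b.coord i) v
  simp only [Module.Basis.coord_apply, smul_eq_mul] at h
  rw [h]
  refine Finset.sum_congr rfl fun j _ => ?_
  rw [mul_comm]
  congr 3
  ext k
  simp [Pi.single_apply, eq_comm]

theorem eval_coordForm (b : Module.Basis (Fin 3) K (Fin 3 → K)) (v : Fin 3 → K) (i : Fin 3) :
    MvPolynomial.eval v (coordForm b i) = b.repr v i := by
  rw [repr_eq_sum b v i, ← MvPolynomial.coe_aeval_eq_eval, coordForm]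
  exact aeval_linForm _ _

theorem aeval_line_coordForm (b : Module.Basis (Fin 3) K (Fin 3 → K)) (v w : Fin 3 → K)
    (i : Fin 3) :
    MvPolynomial.aeval (fun j => (C (v j) + X * C (w j) : K[X])) (coordForm b i) =
      C (b.repr v i) + X * C (b.repr w i) := by
  rw [repr_eq_sum b v i, repr_eq_sum b w i, coordForm, aeval_linForm, map_sum, map_sum,
    Finset.mul_sum, ← Finset.sum_add_distrib]
  refine Finset.sum_congr rfl fun j _ => ?_
  rw [algebraMap_eq, C_mul, C_mul]
  ring

theorem coordForm_ne_zero (b : Module.Basis (Fin 3) K (Fin 3 → K)) (i : Fin 3) :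
    coordForm b i ≠ 0 := by
  intro h
  have := eval_coordForm b (b i) i
  simp [h] at this

/-- The polynomial that expresses `p` in the coordinates with respect to the basis `b`. -/
def inCoords (b : Module.Basis (Fin 3) K (Fin 3 → K)) (p : MvPolynomial (Fin 3) K) :
    MvPolynomial (Fin 3) K :=
  MvPolynomial.aeval (fun j => linForm fun i => b i j) p

theorem inCoords_isHomogeneous (b : Module.Basis (Fin 3) K (Fin 3 → K))
    {p : MvPolynomial (Fin 3) K} {n : ℕ} (hp : p.IsHomogeneous n) :
    (inCoords b p).IsHomogeneous n := by
  have := hp.aeval (fun j => linForm fun i => b i j) (n := 1) fun j => linForm_isHomogeneous _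
  rwa [one_mul] at this

theorem aeval_coordForm_inCoords (b : Module.Basis (Fin 3) K (Fin 3 → K))
    (p : MvPolynomial (Fin 3) K) : MvPolynomial.aeval (coordForm b) (inCoords b p) = p := by
  rw [inCoords, ← AlgHom.comp_apply, MvPolynomial.comp_aeval]
  conv_rhs => rw [← MvPolynomial.aeval_X_left_apply p]
  congr 2
  ext1 j
  rw [aeval_linForm]
  have h : ∀ k, ∑ i, b i j * b.repr (Pi.single k 1) i = (Pi.single k 1 : Fin 3 → K) j := by
    intro k
    conv_rhs => rw [← b.sum_repr (Pi.single k 1)]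
    simp [Finset.sum_apply, mul_comm]
  simp only [coordForm, linForm, Finset.mul_sum, MvPolynomial.algebraMap_eq]
  rw [Finset.sum_comm]
  calc ∑ k, ∑ i, MvPolynomial.C (b i j) *
        (MvPolynomial.C (b.repr (Pi.single k 1) i) * MvPolynomial.X k)
      = ∑ k, MvPolynomial.C (∑ i, b i j * b.repr (Pi.single k 1) i) * MvPolynomial.X k := by
        refine Finset.sum_congr rfl fun k _ => ?_
        rw [map_sum, Finset.sum_mul]
        refine Finset.sum_congr rfl fun i _ => ?_
        rw [MvPolynomial.C_mul, mul_assoc]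
    _ = MvPolynomial.X j := by
        simp only [h, Pi.single_apply]
        rw [Finset.sum_eq_single j]
        · simp
        · intro k _ hk; simp [Ne.symm hk]
        · simp

theorem aeval_smul_of_isHomogeneous {σ A : Type*} [CommRing A] [Algebra K A]
    {p : MvPolynomial σ K} {n : ℕ} (hp : p.IsHomogeneous n) (r : A) (v : σ → A) :
    MvPolynomial.aeval (fun i => r * v i) p = r ^ n * MvPolynomial.aeval v p := by
  rw [MvPolynomial.aeval_def, MvPolynomial.aeval_def, MvPolynomial.eval₂_eq,
    MvPolynomial.eval₂_eq, Finset.mul_sum]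
  refine Finset.sum_congr rfl fun d hd => ?_
  have h1 := hp (MvPolynomial.mem_support_iff.1 hd)
  rw [Finsupp.weight_apply, Finsupp.sum] at h1
  simp only [Pi.one_apply, smul_eq_mul, mul_one] at h1
  simp only [mul_pow]
  rw [Finset.prod_mul_distrib, Finset.prod_pow_eq_pow_sum, h1]
  ring

/-- A ternary form as a combination of monomials, the exponent of the last variable being determined
by the other two. -/
theorem exists_expansion {p : MvPolynomial (Fin 3) K} {n : ℕ} (hp : p.IsHomogeneous n) :
    ∃ a : ℕ → ℕ → K, p = ∑ i ∈ Finset.range (n + 1), ∑ j ∈ Finset.range (n + 1 - i),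
      MvPolynomial.C (a i j) * MvPolynomial.X 0 ^ i * MvPolynomial.X 1 ^ j *
        MvPolynomial.X 2 ^ (n - i - j) := by
  let e : ℕ → ℕ → Fin 3 →₀ ℕ := fun i j => Finsupp.equivFunOnFinite.symm ![i, j, n - i - j]
  have hdeg : ∀ d : Fin 3 →₀ ℕ, p.coeff d ≠ 0 → d 0 + d 1 + d 2 = n := by
    intro d hd
    have h1 := hp hd
    rw [Finsupp.weight_apply, Finsupp.sum_fintype _ _ (by simp)] at h1
    simpa [Fin.sum_univ_three] using h1
  have hmon : ∀ i j, ∀ c : K, MvPolynomial.C c * MvPolynomial.X 0 ^ i * MvPolynomial.X 1 ^ j *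
      MvPolynomial.X 2 ^ (n - i - j) = MvPolynomial.monomial (e i j) c := by
    intro i j c
    rw [MvPolynomial.monomial_eq, Finsupp.prod_fintype _ _ (by simp)]
    simp [Fin.prod_univ_three, e, mul_assoc]
  refine ⟨fun i j => p.coeff (e i j), ?_⟩
  simp only [hmon]
  ext d
  rw [Finset.sum_sigma', MvPolynomial.coeff_sum]
  simp only [MvPolynomial.coeff_monomial]
  by_cases hd : p.coeff d = 0
  · rw [hd, Finset.sum_eq_zero]
    intro x _
    split_ifs with h
    · rw [h, hd]
    · rfl
  · have h1 := hdeg d hd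
    have he : e (d 0) (d 1) = d := by
      ext k
      fin_cases k <;> simp [e]
      omega
    rw [Finset.sum_eq_single ⟨d 0, d 1⟩]
    · rw [if_pos he, he]
    · rintro ⟨i, j⟩ - hij
      rw [if_neg]
      rintro rfl
      exact hij (by simp [e])
    · intro h
      exact absurd (by simp only [Finset.mem_sigma, Finset.mem_range]; omega) h

theorem eq_sum_coordForm (b : Module.Basis (Fin 3) K (Fin 3 → K)) {l : MvPolynomial (Fin 3) K}
    (hl : l.IsHomogeneous 1) :
    l = MvPolynomial.C (MvPolynomial.eval (b 0) l) * coordForm b 0 +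
      MvPolynomial.C (MvPolynomial.eval (b 1) l) * coordForm b 1 +
      MvPolynomial.C (MvPolynomial.eval (b 2) l) * coordForm b 2 := by
  obtain ⟨a, ha⟩ := exists_expansion (inCoords_isHomogeneous b hl)
  have h := aeval_coordForm_inCoords b l
  rw [ha] at h
  simp [Finset.sum_range_succ] at h
  have h' : ∀ v, MvPolynomial.eval v l = a 0 0 * b.repr v 2 + a 0 1 * b.repr v 1 +
      a 1 0 * b.repr v 0 := by
    intro v
    rw [← h]
    simp [eval_coordForm]
  rw [h', h', h']
  simp
  rw [← h]
  ring

namespace PlaneCurve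

section

variable {d : ℕ} (C : PlaneCurve K d)

theorem toFrac_eq_zero_iff (p : MvPolynomial (Fin 3) K) : C.toFrac p = 0 ↔ C.poly ∣ p := by
  rw [← Ideal.mem_span_singleton, ← Ideal.Quotient.eq_zero_iff_mem]
  exact (FaithfulSMul.algebraMap_eq_zero_iff C.CoordRing (FractionRing C.CoordRing))

theorem toFrac_ne_zero (hd : 2 ≤ d) {l : MvPolynomial (Fin 3) K} (hl : l.IsHomogeneous 1)
    (h0 : l ≠ 0) : C.toFrac l ≠ 0 := by
  rw [Ne, toFrac_eq_zero_iff]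
  rintro ⟨q, rfl⟩
  have h1 := hl.totalDegree h0
  rw [MvPolynomial.totalDegree_mul_of_isDomain (left_ne_zero_of_mul h0)
    (right_ne_zero_of_mul h0), C.isHomogeneous.totalDegree (left_ne_zero_of_mul h0)] at h1
  omega

/-- The quotient of two linear forms, as an element of the function field. -/
def linRatio (hd : 2 ≤ d) (l m : MvPolynomial (Fin 3) K) (hl : l.IsHomogeneous 1)
    (hm : m.IsHomogeneous 1) (h0 : m ≠ 0) : C.functionField :=
  ⟨C.toFrac l / C.toFrac m, 1, l, m, hl, hm, C.toFrac_ne_zero hd hm h0, rfl⟩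

/-- If the linear forms through `P` are the combinations of `l` and `m`, then the subfield given by
the projection from `P` is generated by `l / m`. -/
theorem projectionField_eq (hd : 2 ≤ d) {l m : MvPolynomial (Fin 3) K} (hl : l.IsHomogeneous 1)
    (hm : m.IsHomogeneous 1) (h0 : m ≠ 0) {P : Plane K}
    (hlP : MvPolynomial.eval P.rep l = 0) (hmP : MvPolynomial.eval P.rep m = 0)
    (hspan : ∀ q : MvPolynomial (Fin 3) K, q.IsHomogeneous 1 → MvPolynomial.eval P.rep q = 0 →
      ∃ s t : K, q = MvPolynomial.C s * l + MvPolynomial.C t * m) :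
    C.projectionField P = K⟮C.linRatio hd l m hl hm h0⟯ := by
  have hm0 := C.toFrac_ne_zero hd hm h0
  apply le_antisymm
  · rw [projectionField, adjoin_le_iff]
    rintro z ⟨l', m', hl', hm', hlP', hmP', h0', hz⟩
    obtain ⟨s, t, rfl⟩ := hspan l' hl' hlP'
    obtain ⟨s', t', rfl⟩ := hspan m' hm' hmP'
    set h := C.linRatio hd l m hl hm h0 with hh
    have hmem : h ∈ K⟮h⟯ := mem_adjoin_simple_self K h
    have hC : ∀ r : K, C.toFrac (MvPolynomial.C r) =
        ((algebraMap K C.functionField r : C.functionField) : FractionRing C.CoordRing) :=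
      fun r => C.toFrac.commutes r
    have e : z = (algebraMap K C.functionField s * h + algebraMap K C.functionField t) /
        (algebraMap K C.functionField s' * h + algebraMap K C.functionField t') := by
      apply Subtype.ext
      rw [hz]
      have hval : (h : FractionRing C.CoordRing) = C.toFrac l / C.toFrac m := rfl
      simp only [map_add, map_mul, hC] at h0' ⊢
      push_cast
      rw [hval, eq_comm, ← mul_div_mul_right _ _ hm0]
      congr 1 <;> field_simp
    rw [e]
    have hlin : ∀ s t : K, algebraMap K C.functionField s * h + algebraMap K C.functionField t ∈
        K⟮h⟯ := fun s t =>
      add_mem (mul_mem (IntermediateField.algebraMap_mem _ s) hmem)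
        (IntermediateField.algebraMap_mem _ t)
    exact div_mem (hlin s t) (hlin s' t')
  · rw [adjoin_simple_le_iff]
    exact subset_adjoin _ _ ⟨l, m, hl, hm, hlP, hmP, hm0, rfl⟩

/-- The affine coordinate functions generate the function field. -/
theorem adjoin_coord_eq_top (hd : 2 ≤ d) (b : Module.Basis (Fin 3) K (Fin 3 → K)) :
    IntermediateField.adjoin K
      {C.linRatio hd (coordForm b 1) (coordForm b 0) (coordForm_isHomogeneous b 1)
        (coordForm_isHomogeneous b 0) (coordForm_ne_zero b 0),
      C.linRatio hd (coordForm b 2) (coordForm b 0) (coordForm_isHomogeneous b 2)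
        (coordForm_isHomogeneous b 0) (coordForm_ne_zero b 0)} = ⊤ := by
  set f := C.linRatio hd (coordForm b 1) (coordForm b 0) (coordForm_isHomogeneous b 1)
    (coordForm_isHomogeneous b 0) (coordForm_ne_zero b 0) with hf
  set g := C.linRatio hd (coordForm b 2) (coordForm b 0) (coordForm_isHomogeneous b 2)
    (coordForm_isHomogeneous b 0) (coordForm_ne_zero b 0) with hg
  have hx := C.toFrac_ne_zero hd (coordForm_isHomogeneous b 0) (coordForm_ne_zero b 0)
  have key : ∀ (n : ℕ) (p : MvPolynomial (Fin 3) K), p.IsHomogeneous n →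
      C.toFrac p = C.toFrac (coordForm b 0) ^ n *
        ((MvPolynomial.aeval ![1, f, g] (inCoords b p) : C.functionField) :
          FractionRing C.CoordRing) := by
    intro n p hp
    have e1 : ((MvPolynomial.aeval ![1, f, g] (inCoords b p) : C.functionField) :
        FractionRing C.CoordRing) =
        MvPolynomial.aeval (fun i => ((![1, f, g] i : C.functionField) :
          FractionRing C.CoordRing)) (inCoords b p) := by
      have := MvPolynomial.map_aeval (![1, f, g] : Fin 3 → C.functionField)
        (algebraMap C.functionField (FractionRing C.CoordRing)) (inCoords b p)
      exact this
    rw [e1, ← aeval_smul_of_isHomogeneous (inCoords_isHomogeneous b hp)]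
    conv_lhs => rw [← aeval_coordForm_inCoords b p, ← AlgHom.comp_apply, MvPolynomial.comp_aeval]
    congr 2
    ext1 i
    fin_cases i
    · simp
    · exact (mul_div_cancel₀ _ hx).symm
    · exact (mul_div_cancel₀ _ hx).symm
  have hmem : ∀ p : MvPolynomial (Fin 3) K,
      MvPolynomial.aeval ![1, f, g] p ∈ IntermediateField.adjoin K {f, g} := by
    intro p
    induction p using MvPolynomial.induction_on with
    | C a =>
      rw [MvPolynomial.aeval_C]
      exact IntermediateField.algebraMap_mem _ a
    | add p q hp hq => rw [map_add]; exact add_mem hp hq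
    | mul_X p i hp =>
      rw [map_mul, MvPolynomial.aeval_X]
      refine mul_mem hp ?_
      fin_cases i
      · exact one_mem _
      · exact subset_adjoin K _ (by simp)
      · exact subset_adjoin K _ (by simp)
  rw [_root_.eq_top_iff]
  rintro z -
  obtain ⟨n, p, q, hp, hq, hq0, hz⟩ := z.2
  have e : z = MvPolynomial.aeval ![1, f, g] (inCoords b p) /
      MvPolynomial.aeval ![1, f, g] (inCoords b q) := by
    apply Subtype.ext
    rw [hz, key n p hp, key n q hq, mul_div_mul_left _ _ (pow_ne_zero n hx)]
    rfl
  rw [e]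
  exact div_mem (hmem _) (hmem _)

end

end PlaneCurve

/-! ### Hyperflexes and the normal form -/

theorem coeff_one_eq_eval_derivative (q : K[X]) : q.coeff 1 = (derivative q).eval 0 := by
  rw [← coeff_zero_eq_eval_zero, coeff_derivative]
  simp

namespace PlaneCurve

/-- The differential of the defining form at `P` is the linear term in the expansion of the form
along lines through `P`. -/
theorem differential_apply {d : ℕ} (C : PlaneCurve K d) (P : Plane K) (w : Fin 3 → K) :
    C.differential P w = (C.restrictToLine P.rep w).coeff 1 := by
  have key : ∀ (v : Fin 3 → K) (φ : MvPolynomial (Fin 3) K →ₐ[K] K[X]),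
      (∀ i, φ (MvPolynomial.X i) = Polynomial.C (v i) + X * Polynomial.C (w i)) →
      ∀ p : MvPolynomial (Fin 3) K, (φ p).eval 0 = MvPolynomial.eval v p ∧
      (derivative (φ p)).eval 0 = ∑ i, MvPolynomial.eval v (MvPolynomial.pderiv i p) * w i := by
    intro v φ hφ p
    induction p using MvPolynomial.induction_on with
    | C a =>
      rw [← MvPolynomial.algebraMap_eq, AlgHom.commutes]
      simp
    | add p q hp hq =>
      refine ⟨by rw [map_add, eval_add, hp.1, hq.1, map_add], ?_⟩
      simp only [map_add, eval_add, hp.2, hq.2, add_mul, Finset.sum_add_distrib]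
    | mul_X p j hp =>
      refine ⟨by rw [map_mul, eval_mul, hp.1, hφ]; simp, ?_⟩
      rw [map_mul, hφ, derivative_mul, eval_add, eval_mul, eval_mul, hp.1, hp.2]
      simp only [Derivation.leibniz, MvPolynomial.pderiv_X, smul_eq_mul, map_add, map_mul,
        MvPolynomial.eval_X, add_mul, Finset.sum_add_distrib]
      simp [Pi.single_apply, Finset.sum_mul, apply_ite]
      rw [add_comm]
      congr 1
      exact Finset.sum_congr rfl fun i _ => by ring
  rw [coeff_one_eq_eval_derivative, restrictToLine,
    (key P.rep _ (fun i => MvPolynomial.aeval_X _ i) C.poly).2, differential]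
  simp

theorem mem_tangentLine {d : ℕ} (C : PlaneCurve K d) (P : Plane K) (w : Fin 3 → K) :
    w ∈ C.tangentLine P ↔ (C.restrictToLine P.rep w).coeff 1 = 0 := by
  rw [tangentLine, LinearMap.mem_ker, differential_apply]

end PlaneCurve

/-- Coordinates, given by the basis `b`, in which the equation of a quartic is
`κ y⁴ + x z Q(x, y, z) = 0`, with `κ` and the values `α`, `γ` of `Q` at `(1 : 0 : 0)` and
`(0 : 0 : 1)` nonzero. This says that these two points are smooth, with tangent lines `z = 0` and
`x = 0` which meet the curve in no other point. -/
structure NormalForm (C : PlaneCurve K 4) (b : Module.Basis (Fin 3) K (Fin 3 → K)) where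
  /-- the coefficient of `y⁴` -/
  κ : K
  /-- the coefficient of `x³ z` -/
  α : K
  /-- the coefficient of `x² z²` -/
  β : K
  /-- the coefficient of `x z³` -/
  γ : K
  /-- the coefficient of `x² y z` -/
  δ : K
  /-- the coefficient of `x y z²` -/
  ε : K
  /-- the coefficient of `x y² z` -/
  ζ : K
  κ_ne : κ ≠ 0
  α_ne : α ≠ 0
  γ_ne : γ ≠ 0
  poly_eq : C.poly = MvPolynomial.C κ * coordForm b 1 ^ 4 + coordForm b 0 * coordForm b 2 *
    (MvPolynomial.C α * coordForm b 0 ^ 2 + MvPolynomial.C β * coordForm b 0 * coordForm b 2 +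
      MvPolynomial.C γ * coordForm b 2 ^ 2 + MvPolynomial.C δ * coordForm b 0 * coordForm b 1 +
      MvPolynomial.C ε * coordForm b 1 * coordForm b 2 + MvPolynomial.C ζ * coordForm b 1 ^ 2)

/-- A rational parametrization `(1 : w₁ X + w₂ X² + w₃ X³ : X⁴)` of a curve in normal form, with
`w₁` and `w₃` nonzero, given by an isomorphism of the function field with `K(X)`. -/
structure Param (C : PlaneCurve K 4) (b : Module.Basis (Fin 3) K (Fin 3 → K)) where
  /-- the isomorphism of the function field with `K(X)` -/
  ψ : C.functionField ≃ₐ[K] RatFunc K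
  /-- the coefficient of `X` -/
  w₁ : K
  /-- the coefficient of `X²` -/
  w₂ : K
  /-- the coefficient of `X³` -/
  w₃ : K
  w₁_ne : w₁ ≠ 0
  w₃_ne : w₃ ≠ 0
  map_y : ψ (C.linRatio (by norm_num) (coordForm b 1) (coordForm b 0) (coordForm_isHomogeneous b 1)
    (coordForm_isHomogeneous b 0) (coordForm_ne_zero b 0)) = algebraMap K[X] (RatFunc K)
      (Polynomial.C w₁ * X + Polynomial.C w₂ * X ^ 2 + Polynomial.C w₃ * X ^ 3)
  map_z : ψ (C.linRatio (by norm_num) (coordForm b 2) (coordForm b 0) (coordForm_isHomogeneous b 2)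
    (coordForm_isHomogeneous b 0) (coordForm_ne_zero b 0)) = algebraMap K[X] (RatFunc K) (X ^ 4)

namespace NormalForm

variable {C : PlaneCurve K 4} {b : Module.Basis (Fin 3) K (Fin 3 → K)} (N : NormalForm C b)

/-- The equation of the curve, as a function of the coordinates. -/
def form {A : Type*} [CommRing A] [Algebra K A] (x y z : A) : A :=
  algebraMap K A N.κ * y ^ 4 + x * z * (algebraMap K A N.α * x ^ 2 + algebraMap K A N.β * x * z +
    algebraMap K A N.γ * z ^ 2 + algebraMap K A N.δ * x * y + algebraMap K A N.ε * y * z +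
    algebraMap K A N.ζ * y ^ 2)

theorem map_form {A B : Type*} [CommRing A] [Algebra K A] [CommRing B] [Algebra K B]
    (φ : A →ₐ[K] B) (x y z : A) : φ (N.form x y z) = N.form (φ x) (φ y) (φ z) := by
  simp [form]

theorem map_poly {A : Type*} [CommRing A] [Algebra K A] (φ : MvPolynomial (Fin 3) K →ₐ[K] A) :
    φ C.poly = N.form (φ (coordForm b 0)) (φ (coordForm b 1)) (φ (coordForm b 2)) := by
  have h : C.poly = N.form (coordForm b 0) (coordForm b 1) (coordForm b 2) := N.poly_eq
  rw [h, map_form]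

theorem mem_points (P : Plane K) : P ∈ C.points ↔
    N.form (b.repr P.rep 0) (b.repr P.rep 1) (b.repr P.rep 2) = 0 := by
  have h : MvPolynomial.eval P.rep C.poly = N.form (MvPolynomial.eval P.rep (coordForm b 0))
      (MvPolynomial.eval P.rep (coordForm b 1)) (MvPolynomial.eval P.rep (coordForm b 2)) :=
    N.map_poly (MvPolynomial.aeval P.rep)
  simp only [eval_coordForm] at h
  rw [← h]
  rfl

theorem restrictToLine_eq (v w : Fin 3 → K) : C.restrictToLine v w =
    N.form (Polynomial.C (b.repr v 0) + X * Polynomial.C (b.repr w 0))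
      (Polynomial.C (b.repr v 1) + X * Polynomial.C (b.repr w 1))
      (Polynomial.C (b.repr v 2) + X * Polynomial.C (b.repr w 2)) := by
  rw [← aeval_line_coordForm, ← aeval_line_coordForm, ← aeval_line_coordForm]
  exact N.map_poly _

theorem differential_apply (P : Plane K) {x y z : K} (hx : b.repr P.rep 0 = x)
    (hy : b.repr P.rep 1 = y) (hz : b.repr P.rep 2 = z) (w : Fin 3 → K) :
    C.differential P w =
      z * (3 * N.α * x ^ 2 + 2 * N.β * x * z + N.γ * z ^ 2 + 2 * N.δ * x * y + N.ε * y * z +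
        N.ζ * y ^ 2) * b.repr w 0 +
      (4 * N.κ * y ^ 3 + x * z * (N.δ * x + N.ε * z + 2 * N.ζ * y)) * b.repr w 1 +
      x * (N.α * x ^ 2 + 2 * N.β * x * z + 3 * N.γ * z ^ 2 + N.δ * x * y + 2 * N.ε * y * z +
        N.ζ * y ^ 2) * b.repr w 2 := by
  subst hx hy hz
  rw [C.differential_apply, coeff_one_eq_eval_derivative, N.restrictToLine_eq]
  simp [form, derivative_pow]
  ring

/-- The normal form is symmetric under exchanging the first and the last coordinate. -/
def symm : NormalForm C (b.reindex (Equiv.swap 0 2)) where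
  κ := N.κ
  α := N.γ
  β := N.β
  γ := N.α
  δ := N.ε
  ε := N.δ
  ζ := N.ζ
  κ_ne := N.κ_ne
  α_ne := N.γ_ne
  γ_ne := N.α_ne
  poly_eq := by
    have h : ∀ i, coordForm (b.reindex (Equiv.swap 0 2)) i = coordForm b (Equiv.swap 0 2 i) := by
      intro i
      simp [coordForm]
    rw [h, h, h, N.poly_eq]
    simp only [Equiv.swap_apply_left, Equiv.swap_apply_right,
      show (Equiv.swap 0 2 : Equiv.Perm (Fin 3)) 1 = 1 from rfl]
    ring

theorem repr_of_rep {P : Plane K} {v : Fin 3 → K} {hv : v ≠ 0}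
    (hP : P = Projectivization.mk K v hv) :
    ∃ r : K, r ≠ 0 ∧ ∀ i, b.repr P.rep i = r * b.repr v i := by
  obtain ⟨a, ha⟩ := Projectivization.exists_smul_eq_mk_rep K v hv
  refine ⟨a, a.ne_zero, fun i => ?_⟩
  rw [hP, ← ha, Units.smul_def, map_smul]
  rfl

/-- The point `(0 : 0 : 1)` is a smooth point of the curve, at which the tangent line has contact of
order four. -/
theorem isSmoothPoint_and_intersectionMultiplicity (N : NormalForm C b) {P : Plane K}
    (hP : P = Projectivization.mk K (b 2) (b.ne_zero 2)) :
    C.IsSmoothPoint P ∧ C.intersectionMultiplicity P (C.tangentLine P) = 4 := by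
  obtain ⟨r, hr, hrep⟩ := repr_of_rep (b := b) hP
  have h0 : b.repr P.rep 0 = 0 := by simp [hrep]
  have h1 : b.repr P.rep 1 = 0 := by simp [hrep]
  have h2 : b.repr P.rep 2 = r := by simp [hrep]
  have hd : ∀ w, C.differential P w = N.γ * r ^ 3 * b.repr w 0 := by
    intro w
    rw [N.differential_apply P h0 h1 h2]
    ring
  have hc : N.γ * r ^ 3 ≠ 0 := mul_ne_zero N.γ_ne (pow_ne_zero 3 hr)
  have htan : ∀ w, w ∈ C.tangentLine P ↔ b.repr w 0 = 0 := by
    intro w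
    rw [PlaneCurve.tangentLine, LinearMap.mem_ker, hd, mul_eq_zero, or_iff_right hc]
  refine ⟨⟨?_, ?_⟩, ?_⟩
  · rw [N.mem_points, h0, h1]
    simp [form]
  · intro h
    have := hd (b 0)
    rw [h] at this
    simp at this
    exact hc (by simpa using this)
  · have hmul : ∀ w ∈ {w : Fin 3 → K | w ∈ C.tangentLine P ∧ w ∉ P.submodule},
        emultiplicity X (C.restrictToLine P.rep w) = 4 := by
      rintro w ⟨hw, hwP⟩
      have hw0 := (htan w).1 hw
      have hw1 : b.repr w 1 ≠ 0 := by
        intro hw1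
        apply hwP
        rw [hP, Projectivization.submodule_mk, Submodule.mem_span_singleton]
        refine ⟨b.repr w 2, ?_⟩
        have h := b.sum_repr w
        rw [Fin.sum_univ_three, hw0, hw1] at h
        simpa using h
      have e : C.restrictToLine P.rep w = Polynomial.C (N.κ * b.repr w 1 ^ 4) * X ^ 4 := by
        rw [N.restrictToLine_eq, h0, h1, hw0]
        simp [form]
        ring
      rw [e, show (4 : ℕ∞) = ((4 : ℕ) : ℕ∞) from rfl, emultiplicity_eq_coe]
      refine ⟨dvd_mul_left _ _, fun h => ?_⟩
      have := (X_pow_dvd_iff.1 h) 4 (by norm_num)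
      rw [coeff_C_mul_X_pow, if_pos rfl] at this
      exact mul_ne_zero N.κ_ne (pow_ne_zero 4 hw1) this
    have hne : b 1 ∈ {w : Fin 3 → K | w ∈ C.tangentLine P ∧ w ∉ P.submodule} := by
      refine ⟨(htan _).2 (by simp), fun h => ?_⟩
      rw [hP, Projectivization.submodule_mk, Submodule.mem_span_singleton] at h
      obtain ⟨a, ha⟩ := h
      have := congrArg (fun v => b.repr v 1) ha
      simp at this
    apply le_antisymm
    · exact (iInf₂_le _ hne).trans (hmul _ hne).le
    · exact le_iInf₂ fun w hw => (hmul w hw).ge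

theorem form_linRatio : N.form 1 (C.linRatio (by norm_num) (coordForm b 1) (coordForm b 0)
    (coordForm_isHomogeneous b 1) (coordForm_isHomogeneous b 0) (coordForm_ne_zero b 0))
    (C.linRatio (by norm_num) (coordForm b 2) (coordForm b 0) (coordForm_isHomogeneous b 2)
    (coordForm_isHomogeneous b 0) (coordForm_ne_zero b 0)) = 0 := by
  apply Subtype.ext
  have h : C.toFrac C.poly = 0 := (C.toFrac_eq_zero_iff _).2 dvd_rfl
  have hx := C.toFrac_ne_zero (by norm_num) (coordForm_isHomogeneous b 0) (coordForm_ne_zero b 0)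
  rw [N.map_poly] at h
  refine (N.map_form C.functionField.val _ _ _).trans ?_
  change N.form (1 : FractionRing C.CoordRing) (C.toFrac (coordForm b 1) / C.toFrac (coordForm b 0))
    (C.toFrac (coordForm b 2) / C.toFrac (coordForm b 0)) = 0
  rw [form] at h ⊢
  field_simp
  linear_combination h

theorem nonempty_param [IsAlgClosed K] (N : NormalForm C b) (hC : C.IsRational) :
    Nonempty (Param C b) := by
  obtain ⟨ψ₀⟩ := hC
  have hrel := N.form_linRatio
  rw [form] at hrel
  obtain ⟨ψ, w₁, w₂, w₃, h₁, h₃, hg, hf⟩ := exists_parametrization ψ₀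
    (C.adjoin_coord_eq_top (by norm_num) b) N.κ_ne N.γ_ne N.α_ne
    (β := N.β) (δ := N.δ) (ε := N.ε) (ζ := N.ζ) (by rw [← hrel]; ring)
  exact ⟨⟨ψ, w₁, w₂, w₃, h₁, h₃, hf, by rw [hg, map_pow, RatFunc.algebraMap_X]⟩⟩

end NormalForm

/-! ### The inner Galois points at the two hyperflexes -/

/-- The linear form with coefficients `a` in the coordinates with respect to the basis `b`. -/
def combForm (b : Module.Basis (Fin 3) K (Fin 3 → K)) (a : Fin 3 → K) :
    MvPolynomial (Fin 3) K :=
  MvPolynomial.C (a 0) * coordForm b 0 + MvPolynomial.C (a 1) * coordForm b 1 +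
    MvPolynomial.C (a 2) * coordForm b 2

theorem combForm_isHomogeneous (b : Module.Basis (Fin 3) K (Fin 3 → K)) (a : Fin 3 → K) :
    (combForm b a).IsHomogeneous 1 := by
  have h : ∀ i, (MvPolynomial.C (a i) * coordForm b i).IsHomogeneous 1 := fun i => by
    simpa using (MvPolynomial.isHomogeneous_C (Fin 3) (a i)).mul (coordForm_isHomogeneous b i)
  exact ((h 0).add (h 1)).add (h 2)

theorem eval_combForm (b : Module.Basis (Fin 3) K (Fin 3 → K)) (a v : Fin 3 → K) :
    MvPolynomial.eval v (combForm b a) =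
      a 0 * b.repr v 0 + a 1 * b.repr v 1 + a 2 * b.repr v 2 := by
  simp [combForm, eval_coordForm]

theorem combForm_ne_zero (b : Module.Basis (Fin 3) K (Fin 3 → K)) {a : Fin 3 → K} (ha : a ≠ 0) :
    combForm b a ≠ 0 := by
  intro h
  apply ha
  ext i
  have := eval_combForm b a (b i)
  rw [h] at this
  fin_cases i <;> simpa using this.symm

theorem map_linRatio_combForm {C : PlaneCurve K 4} {b : Module.Basis (Fin 3) K (Fin 3 → K)}
    (a : Fin 3 → K) {a' : Fin 3 → K} (ha' : a' ≠ 0) :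
    C.linRatio (by norm_num) (combForm b a) (combForm b a') (combForm_isHomogeneous b a)
      (combForm_isHomogeneous b a') (combForm_ne_zero b ha') =
    (algebraMap K _ (a 0) + algebraMap K _ (a 1) *
      C.linRatio (by norm_num) (coordForm b 1) (coordForm b 0) (coordForm_isHomogeneous b 1)
        (coordForm_isHomogeneous b 0) (coordForm_ne_zero b 0) + algebraMap K _ (a 2) *
      C.linRatio (by norm_num) (coordForm b 2) (coordForm b 0) (coordForm_isHomogeneous b 2)
        (coordForm_isHomogeneous b 0) (coordForm_ne_zero b 0)) /
    (algebraMap K _ (a' 0) + algebraMap K _ (a' 1) *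
      C.linRatio (by norm_num) (coordForm b 1) (coordForm b 0) (coordForm_isHomogeneous b 1)
        (coordForm_isHomogeneous b 0) (coordForm_ne_zero b 0) + algebraMap K _ (a' 2) *
      C.linRatio (by norm_num) (coordForm b 2) (coordForm b 0) (coordForm_isHomogeneous b 2)
        (coordForm_isHomogeneous b 0) (coordForm_ne_zero b 0)) := by
  apply Subtype.ext
  have hx := C.toFrac_ne_zero (by norm_num) (coordForm_isHomogeneous b 0) (coordForm_ne_zero b 0)
  have h : ∀ a : Fin 3 → K, C.toFrac (combForm b a) = C.toFrac (coordForm b 0) *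
      (algebraMap K _ (a 0) + algebraMap K _ (a 1) *
        (C.toFrac (coordForm b 1) / C.toFrac (coordForm b 0)) + algebraMap K _ (a 2) *
        (C.toFrac (coordForm b 2) / C.toFrac (coordForm b 0))) := by
    intro a
    have hC : ∀ r : K, C.toFrac (MvPolynomial.C r) = algebraMap K _ r :=
      fun r => C.toFrac.commutes r
    simp only [combForm, map_add, map_mul, hC]
    field_simp
  change C.toFrac (combForm b a) / C.toFrac (combForm b a') = _
  rw [h, h, mul_div_mul_left _ _ hx]
  rfl

theorem coeffs_eq_zero_of_quadratic_eq_zero {u v w : K}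
    (h : Polynomial.C u * X ^ 2 + Polynomial.C v * X + Polynomial.C w = 0) :
    u = 0 ∧ v = 0 ∧ w = 0 := by
  have c (n : ℕ) := congrArg (fun p => p.coeff n) h
  simp only [coeff_add, coeff_C_mul, coeff_X_pow, coeff_X, coeff_C, coeff_zero] at c
  exact ⟨by simpa using c 2, by simpa using c 1, by simpa using c 0⟩

namespace Param

variable {C : PlaneCurve K 4} {b : Module.Basis (Fin 3) K (Fin 3 → K)} (T : Param C b)

/-- The second coordinate of the parametrization. -/
def W : K[X] := Polynomial.C T.w₁ * X + Polynomial.C T.w₂ * X ^ 2 + Polynomial.C T.w₃ * X ^ 3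

/-- The pullback of a linear form along the parametrization. -/
def lin (a : Fin 3 → K) : K[X] :=
  Polynomial.C (a 0) + Polynomial.C (a 1) * T.W + Polynomial.C (a 2) * X ^ 4

theorem form_W (N : NormalForm C b) : N.form 1 T.W (X ^ 4) = 0 := by
  apply RatFunc.algebraMap_injective K
  have h1 := N.map_form (IsScalarTower.toAlgHom K K[X] (RatFunc K)) 1 T.W (X ^ 4)
  have h2 := congrArg T.ψ N.form_linRatio
  have h3 := N.map_form (T.ψ : C.functionField →ₐ[K] RatFunc K) 1
    (C.linRatio (by norm_num) (coordForm b 1) (coordForm b 0)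
    (coordForm_isHomogeneous b 1) (coordForm_isHomogeneous b 0) (coordForm_ne_zero b 0))
    (C.linRatio (by norm_num) (coordForm b 2) (coordForm b 0)
    (coordForm_isHomogeneous b 2) (coordForm_isHomogeneous b 0) (coordForm_ne_zero b 0))
  change T.ψ _ = N.form (T.ψ 1) (T.ψ _) (T.ψ _) at h3
  rw [T.map_y, T.map_z, h2] at h3
  rw [map_zero]
  rw [map_zero, map_one] at h3
  rw [map_one] at h1
  exact h1.trans h3.symm

/-- Whether a point is a Galois point, in terms of the parametrization: the projection from the
point is given by two linear forms `a`, `a'` which span the linear forms through it. -/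
theorem isInnerGalois_iff {P : Plane K} (hP : P ∈ C.points) {a a' : Fin 3 → K} (ha' : a' ≠ 0)
    (h : a 0 * b.repr P.rep 0 + a 1 * b.repr P.rep 1 + a 2 * b.repr P.rep 2 = 0)
    (h' : a' 0 * b.repr P.rep 0 + a' 1 * b.repr P.rep 1 + a' 2 * b.repr P.rep 2 = 0)
    (hspan : ∀ q : Fin 3 → K,
      q 0 * b.repr P.rep 0 + q 1 * b.repr P.rep 1 + q 2 * b.repr P.rep 2 = 0 →
      ∃ s t : K, ∀ i, q i = s * a i + t * a' i) :
    C.IsInnerGalois P ↔ IsGalois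
      K⟮(algebraMap K[X] (RatFunc K) (T.lin a) / algebraMap K[X] (RatFunc K) (T.lin a'))⟯
      (RatFunc K) := by
  have e : algebraMap K[X] (RatFunc K) (T.lin a) / algebraMap K[X] (RatFunc K) (T.lin a') =
      T.ψ (C.linRatio (by norm_num) (combForm b a) (combForm b a') (combForm_isHomogeneous b a)
      (combForm_isHomogeneous b a') (combForm_ne_zero b ha')) := by
    rw [map_linRatio_combForm a ha']
    simp only [map_div₀, map_add, map_mul, T.map_y, T.map_z, AlgEquiv.commutes, lin, W]
    rfl
  rw [e, isGalois_adjoin_simple_map_iff, PlaneCurve.IsInnerGalois, and_iff_right hP,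
    C.projectionField_eq (by norm_num) (combForm_isHomogeneous b a) (combForm_isHomogeneous b a')
      (combForm_ne_zero b ha') (by rw [eval_combForm]; exact h) (by rw [eval_combForm]; exact h')]
  intro q hq hq0
  have hq1 := eq_sum_coordForm b hq
  have hq2 := congrArg (MvPolynomial.eval P.rep) hq1
  simp only [map_add, map_mul, MvPolynomial.eval_C, eval_coordForm, hq0] at hq2
  obtain ⟨s, t, hst⟩ := hspan ![MvPolynomial.eval (b 0) q, MvPolynomial.eval (b 1) q,
    MvPolynomial.eval (b 2) q] hq2.symm
  refine ⟨s, t, ?_⟩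
  have h0 := hst 0
  have h1 := hst 1
  have h2 := hst 2
  simp only [Matrix.cons_val_zero, Matrix.cons_val_one, Matrix.cons_val] at h0 h1 h2
  rw [hq1, h0, h1, h2, combForm, combForm]
  simp only [map_add, map_mul]
  ring

/-- The point `(0 : 0 : 1)` is a Galois point if and only if `K(X)` is Galois over `K(W)`. -/
theorem isInnerGalois_last_iff (N : NormalForm C b) {P : Plane K}
    (hP : P = Projectivization.mk K (b 2) (b.ne_zero 2)) :
    C.IsInnerGalois P ↔ IsGalois K⟮algebraMap K[X] (RatFunc K) T.W⟯ (RatFunc K) := by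
  obtain ⟨r, hr, hrep⟩ := NormalForm.repr_of_rep (b := b) hP
  have hPC := (N.isSmoothPoint_and_intersectionMultiplicity hP).1.1
  have e : algebraMap K[X] (RatFunc K) (T.lin ![0, 1, 0]) /
      algebraMap K[X] (RatFunc K) (T.lin ![1, 0, 0]) = algebraMap K[X] (RatFunc K) T.W := by
    simp [lin]
  rw [T.isInnerGalois_iff hPC (a := ![0, 1, 0]) (a' := ![1, 0, 0]), e]
  · intro h
    have := congrFun h 0
    simp at this
  · simp [hrep]
  · simp [hrep]
  · intro q hq
    simp [hrep, hr] at hq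
    exact ⟨q 1, q 0, fun i => by fin_cases i <;> simp [hq]⟩

theorem isInnerGalois_first_iff (N : NormalForm C b) {P : Plane K}
    (hP : P = Projectivization.mk K (b 0) (b.ne_zero 0)) :
    C.IsInnerGalois P ↔ IsGalois K⟮(algebraMap K[X] (RatFunc K) T.W / RatFunc.X ^ 4)⟯
      (RatFunc K) := by
  obtain ⟨r, hr, hrep⟩ := NormalForm.repr_of_rep (b := b) hP
  have hPC := (N.symm.isSmoothPoint_and_intersectionMultiplicity (P := P)
    (by rw [hP]; congr 1; simp)).1.1
  have e : algebraMap K[X] (RatFunc K) (T.lin ![0, 1, 0]) /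
      algebraMap K[X] (RatFunc K) (T.lin ![0, 0, 1]) =
      algebraMap K[X] (RatFunc K) T.W / RatFunc.X ^ 4 := by
    simp [lin]
  rw [T.isInnerGalois_iff hPC (a := ![0, 1, 0]) (a' := ![0, 0, 1]), e]
  · intro h
    have := congrFun h 2
    simp at this
  · simp [hrep]
  · simp [hrep]
  · intro q hq
    simp [hrep, hr] at hq
    exact ⟨q 1, q 2, fun i => by fin_cases i <;> simp [hq]⟩

/-- The Bézoutian of `W` and `1` is a quadratic polynomial in `Y` whose discriminant is quadratic in
`X`. That this discriminant is a square means that its own discriminant vanishes. -/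
theorem w₂_sq_of_isGalois (h2 : (2 : K) ≠ 0)
    (hG : IsGalois K⟮algebraMap K[X] (RatFunc K) T.W⟯ (RatFunc K)) :
    T.w₂ ^ 2 = 3 * T.w₁ * T.w₃ := by
  have hW3 : T.W.natDegree = 3 := by
    have := T.w₃_ne
    rw [W]
    compute_degree!
  obtain ⟨S, hS⟩ := exists_discrim_eq_sq_of_isGalois (N := T.W) (D := 1)
    (B₂ := Polynomial.C T.w₃) (B₁ := Polynomial.C T.w₃ * X + Polynomial.C T.w₂)
    (B₀ := Polynomial.C T.w₃ * X ^ 2 + Polynomial.C T.w₂ * X + Polynomial.C T.w₁)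
    isCoprime_one_right one_ne_zero (by simp [hW3]) (by simp [W]; ring)
    (Polynomial.C_ne_zero.2 T.w₃_ne) (by rwa [map_one, div_one])
  have hdeg : S.natDegree ≤ 1 := by
    have h1 : (discrim (Polynomial.C T.w₃) (Polynomial.C T.w₃ * X + Polynomial.C T.w₂)
      (Polynomial.C T.w₃ * X ^ 2 + Polynomial.C T.w₂ * X + Polynomial.C T.w₁)).natDegree ≤ 2 := by
      rw [discrim]
      compute_degree
    rw [hS, natDegree_pow] at h1
    omega
  rw [natDegree_le_iff_coeff_eq_zero] at hdeg
  obtain ⟨s, t, rfl⟩ : ∃ s t : K, S = Polynomial.C s * X + Polynomial.C t :=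
    ⟨S.coeff 1, S.coeff 0, eq_X_add_C_of_natDegree_le_one
      (natDegree_le_iff_coeff_eq_zero.2 hdeg)⟩
  have e : Polynomial.C (s ^ 2 + 3 * T.w₃ ^ 2) * X ^ 2 +
      Polynomial.C (2 * s * t + 2 * T.w₂ * T.w₃) * X +
      Polynomial.C (t ^ 2 - T.w₂ ^ 2 + 4 * T.w₁ * T.w₃) = 0 := by
    rw [discrim] at hS
    simp only [map_add, map_sub, map_mul, map_pow, map_ofNat]
    linear_combination -hS
  obtain ⟨c2, c1, c0⟩ := coeffs_eq_zero_of_quadratic_eq_zero e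
  have hst : s * t = - (T.w₂ * T.w₃) := by
    apply mul_left_cancel₀ h2
    linear_combination c1
  -- compare `(s t)²` with `s² t²`
  have h4 : (2 ^ 2 * T.w₃ ^ 2) * (T.w₂ ^ 2 - 3 * T.w₁ * T.w₃) = 0 := by
    linear_combination (-s * t + T.w₂ * T.w₃) * hst + t ^ 2 * c2 - 3 * T.w₃ ^ 2 * c0
  rcases mul_eq_zero.1 h4 with h | h
  · exact absurd h (mul_ne_zero (pow_ne_zero 2 h2) (pow_ne_zero 2 T.w₃_ne))
  · exact sub_eq_zero.1 h

/-- If `w₂² = 3 w₁ w₃`, then `W = k ((X + l)³ - l³)`: completing the cube leaves no linear term. -/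
theorem exists_eq_cube (h3 : (3 : K) ≠ 0) (h : T.w₂ ^ 2 = 3 * T.w₁ * T.w₃) :
    ∃ k l : K, k ≠ 0 ∧ l ≠ 0 ∧ T.w₁ = 3 * k * l ^ 2 ∧ T.w₂ = 3 * k * l ∧ T.w₃ = k := by
  have hw₁ := T.w₁_ne
  have hw₃ := T.w₃_ne
  have hw₂ : T.w₂ ≠ 0 := by
    intro h0
    rw [h0] at h
    have : 3 * T.w₁ * T.w₃ ≠ 0 := mul_ne_zero (mul_ne_zero h3 hw₁) hw₃
    exact this (by rw [← h]; ring)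
  refine ⟨T.w₃, T.w₂ / (3 * T.w₃), hw₃, div_ne_zero hw₂ (mul_ne_zero h3 hw₃), ?_, ?_, rfl⟩
  · field_simp
    linear_combination -h
  · field_simp

theorem isGalois_W [IsAlgClosed K] (h3 : (3 : K) ≠ 0) {k l : K} (hk : k ≠ 0)
    (e₁ : T.w₁ = 3 * k * l ^ 2) (e₂ : T.w₂ = 3 * k * l) (e₃ : T.w₃ = k) :
    IsGalois K⟮algebraMap K[X] (RatFunc K) T.W⟯ (RatFunc K) := by
  refine isGalois_of_cube_mem h3 _ (y := RatFunc.X + RatFunc.C l) ?_ ?_ ?_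
  · intro h
    have : algebraMap K[X] (RatFunc K) (X + Polynomial.C l) = 0 := by simpa using h
    rw [map_eq_zero_iff _ (RatFunc.algebraMap_injective K)] at this
    exact X_add_C_ne_zero l this
  · have e : (RatFunc.X + RatFunc.C l) ^ 3 =
        algebraMap K (RatFunc K) k⁻¹ * algebraMap K[X] (RatFunc K) T.W +
        algebraMap K (RatFunc K) (l ^ 3) := by
      have h1 : (X + Polynomial.C l) ^ 3 = Polynomial.C k⁻¹ * T.W + Polynomial.C (l ^ 3) := by
        have hkk : Polynomial.C k⁻¹ * Polynomial.C k = 1 := by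
          rw [← C_mul, inv_mul_cancel₀ hk, C_1]
        rw [W, e₁, e₂, e₃]
        simp only [C_mul, C_pow, map_ofNat]
        linear_combination (-(3 * Polynomial.C l ^ 2 * X + 3 * Polynomial.C l * X ^ 2 + X ^ 3)) *
          hkk
      have h2 := congrArg (algebraMap K[X] (RatFunc K)) h1
      simpa using h2
    rw [e]
    exact add_mem (mul_mem (IntermediateField.algebraMap_mem _ _) (mem_adjoin_simple_self K _))
      (IntermediateField.algebraMap_mem _ _)
  · rw [_root_.eq_top_iff, ← RatFunc.adjoin_X, adjoin_simple_le_iff]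
    have := sub_mem (mem_adjoin_simple_self K (RatFunc.X + RatFunc.C l))
      (IntermediateField.algebraMap_mem K⟮RatFunc.X + RatFunc.C l⟯ l)
    rwa [RatFunc.algebraMap_eq_C, add_sub_cancel_right] at this

theorem isGalois_W_div [IsAlgClosed K] (h3 : (3 : K) ≠ 0) {k l : K} (hk : k ≠ 0) (hl : l ≠ 0)
    (e₁ : T.w₁ = 3 * k * l ^ 2) (e₂ : T.w₂ = 3 * k * l) (e₃ : T.w₃ = k) :
    IsGalois K⟮(algebraMap K[X] (RatFunc K) T.W / RatFunc.X ^ 4)⟯ (RatFunc K) := by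
  have hX : (RatFunc.X : RatFunc K) ≠ 0 := RatFunc.X_ne_zero
  have hmem : ∀ (L : IntermediateField K (RatFunc K)) (r : K), RatFunc.C r ∈ L :=
    fun L r => L.algebraMap_mem r
  set h := algebraMap K[X] (RatFunc K) T.W / RatFunc.X ^ 4 with hh
  have hW : algebraMap K[X] (RatFunc K) T.W = RatFunc.C k * (3 * RatFunc.C l ^ 2 * RatFunc.X +
      3 * RatFunc.C l * RatFunc.X ^ 2 + RatFunc.X ^ 3) := by
    rw [W, e₁, e₂, e₃]
    simp only [map_add, map_mul, map_pow, map_ofNat, RatFunc.algebraMap_C, RatFunc.algebraMap_X]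
    ring
  -- completing the cube in the variable `1 / X`
  refine isGalois_of_cube_mem h3 _ (y := 1 + 3 * RatFunc.C l * RatFunc.X⁻¹) ?_ ?_ ?_
  · intro h0
    have : algebraMap K[X] (RatFunc K) (X + Polynomial.C (3 * l)) = 0 := by
      simp only [map_add, map_mul, map_ofNat, RatFunc.algebraMap_C, RatFunc.algebraMap_X]
      field_simp at h0
      rwa [mul_zero] at h0
    rw [map_eq_zero_iff _ (RatFunc.algebraMap_injective K)] at this
    exact X_add_C_ne_zero _ this
  · have e : (1 + 3 * RatFunc.C l * RatFunc.X⁻¹) ^ 3 = RatFunc.C (9 * l * k⁻¹) * h + 1 := by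
      have hkk : RatFunc.C k⁻¹ * RatFunc.C k = 1 := by
        rw [← map_mul, inv_mul_cancel₀ hk, map_one]
      rw [hh, hW, map_mul, map_mul, map_ofNat]
      generalize RatFunc.C k⁻¹ = k' at hkk ⊢
      field_simp
      linear_combination (-(9 * RatFunc.C l * (3 * RatFunc.C l ^ 2 +
        3 * RatFunc.C l * RatFunc.X + RatFunc.X ^ 2))) * hkk
    rw [e]
    exact add_mem (mul_mem (hmem _ _) (mem_adjoin_simple_self K _)) (one_mem _)
  · rw [_root_.eq_top_iff, ← RatFunc.adjoin_X, adjoin_simple_le_iff]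
    set L := K⟮(1 + 3 * RatFunc.C l * RatFunc.X⁻¹ : RatFunc K)⟯ with hL
    have hy : (1 + 3 * RatFunc.C l * RatFunc.X⁻¹ : RatFunc K) ∈ L := mem_adjoin_simple_self K _
    have e : (RatFunc.X : RatFunc K) =
        RatFunc.C (3 * l) / ((1 + 3 * RatFunc.C l * RatFunc.X⁻¹) - 1) := by
      have hl3 : RatFunc.C (3 * l) ≠ 0 := by
        rw [Ne, map_eq_zero]; exact mul_ne_zero h3 hl
      rw [map_mul, map_ofNat] at hl3 ⊢
      rw [add_sub_cancel_left, div_mul_cancel_left₀ hl3, inv_inv]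
    rw [e]
    exact div_mem (hmem _ _) (sub_mem hy (one_mem _))

end Param

/-! ### The points of the parametrized curve -/

namespace NormalForm

variable {C : PlaneCurve K 4} {b : Module.Basis (Fin 3) K (Fin 3 → K)}

theorem form_mul (N : NormalForm C b) (c x y z : K) :
    N.form (c * x) (c * y) (c * z) = c ^ 4 * N.form x y z := by
  simp only [form]
  ring

end NormalForm

namespace Param

variable {C : PlaneCurve K 4} {b : Module.Basis (Fin 3) K (Fin 3 → K)} (T : Param C b)

theorem eval_W (u : K) : T.W.eval u = T.w₁ * u + T.w₂ * u ^ 2 + T.w₃ * u ^ 3 := by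
  simp [W]

theorem form_eval (N : NormalForm C b) (u : K) : N.form 1 (T.W.eval u) (u ^ 4) = 0 := by
  have h := N.map_form (aeval u : K[X] →ₐ[K] K) 1 T.W (X ^ 4)
  rw [T.form_W N] at h
  simp only [map_zero, map_one, map_pow, aeval_X, coe_aeval_eq_eval] at h
  exact h.symm

theorem form_param (N : NormalForm C b) (s t : K) :
    N.form (s ^ 4) (T.w₁ * s ^ 3 * t + T.w₂ * s ^ 2 * t ^ 2 + T.w₃ * s * t ^ 3) (t ^ 4) = 0 := by
  by_cases hs : s = 0
  · subst hs
    simp [NormalForm.form]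
  · have h := N.form_mul (s ^ 4) 1 (T.W.eval (t / s)) ((t / s) ^ 4)
    rw [T.form_eval, mul_zero, eval_W, mul_one] at h
    rw [← h]
    congr 1 <;> field_simp

/-- The parametrization is surjective. For given `x = 1` and `z = u⁴`, the equation has the four
roots `y = W(u')` with `u'⁴ = u⁴`; since they are distinct for a generic `u`, this is a
factorization of the quartic polynomial in `y` over `K[u]`. -/
theorem exists_eq_of_form_eq_zero [IsAlgClosed K] (h2 : (2 : K) ≠ 0) (N : NormalForm C b)
    {x y z : K} (h : N.form x y z = 0) :
    ∃ s t : K, x = s ^ 4 ∧ y = T.w₁ * s ^ 3 * t + T.w₂ * s ^ 2 * t ^ 2 + T.w₃ * s * t ^ 3 ∧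
      z = t ^ 4 := by
  by_cases hx : x = 0
  · subst hx
    obtain ⟨t, ht⟩ := IsAlgClosed.exists_pow_nat_eq z (n := 4) (by norm_num)
    have hy : y = 0 := by
      simpa [NormalForm.form, N.κ_ne] using h
    exact ⟨0, t, by simp, by simp [hy], ht.symm⟩
  obtain ⟨s, hs⟩ := IsAlgClosed.exists_pow_nat_eq x (n := 4) (by norm_num)
  obtain ⟨t, ht⟩ := IsAlgClosed.exists_pow_nat_eq z (n := 4) (by norm_num)
  obtain ⟨i, hi⟩ := IsAlgClosed.exists_pow_nat_eq (-1 : K) (n := 2) (by norm_num)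
  have hs0 : s ≠ 0 := by rintro rfl; exact hx (by rw [← hs]; simp)
  let ξ : Fin 4 → K := ![1, -1, i, -i]
  have hξ4 : ∀ j, ξ j ^ 4 = 1 := by
    have hi4 : i ^ 4 = 1 := by linear_combination (i ^ 2 - 1) * hi
    intro j
    fin_cases j <;> simp [ξ, hi4, Even.neg_pow (show Even 4 by decide)]
  have hi1 : i ≠ 1 := by
    rintro rfl
    exact h2 (by linear_combination hi)
  have hi1' : i ≠ -1 := by
    rintro rfl
    exact h2 (by linear_combination hi)
  have hi0 : i ≠ 0 := by
    rintro rfl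
    simp at hi
  have hneg : ∀ v : K, v ≠ 0 → v ≠ -v := by
    intro v hv e
    exact mul_ne_zero h2 hv (by linear_combination e)
  have hξ : Function.Injective ξ := by
    have e1 := hneg 1 one_ne_zero
    have e2 := hneg i hi0
    have e3 : (1 : K) ≠ -i := fun e => hi1' (by rw [e, neg_neg])
    have e4 : (-1 : K) ≠ -i := fun e => hi1 (neg_injective e).symm
    intro j k hjk
    fin_cases j <;> fin_cases k <;>
      first
      | rfl
      | (exfalso; simp only [ξ] at hjk; revert hjk;
         simp [e1, e2, e3, e4, hi1, hi1', e1.symm, e2.symm, e3.symm, e4.symm, hi1.symm,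
           hi1'.symm])
  -- the four roots in `K[u]`
  let V : Fin 4 → K[X] := fun j => T.W.comp (Polynomial.C (ξ j) * X)
  have hV : Function.Injective V := by
    intro j k hjk
    apply hξ
    have h1 : ∀ j, (derivative (V j)).eval 0 = T.w₁ * ξ j := by
      intro j
      simp [V, W, derivative_pow]
    have h3 := h1 j
    rw [hjk, h1 k] at h3
    exact (mul_left_cancel₀ T.w₁_ne h3).symm
  have hVroot : ∀ j, N.form 1 (V j) (X ^ 4) = 0 := by
    intro j
    have h1 := N.map_form (aeval (Polynomial.C (ξ j) * X) : K[X] →ₐ[K] K[X]) 1 T.W (X ^ 4)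
    rw [T.form_W N, map_zero, map_one, map_pow, aeval_X, mul_pow, ← C_pow, hξ4, C_1, one_mul] at h1
    exact h1.symm
  let q : K[X][X] := N.form (1 : K[X][X]) X (Polynomial.C (X ^ 4)) -
    Polynomial.C (Polynomial.C N.κ) * ((X - Polynomial.C (V 0)) * (X - Polynomial.C (V 1)) *
      (X - Polynomial.C (V 2)) * (X - Polynomial.C (V 3)))
  have hqdeg : q.natDegree ≤ 3 := by
    obtain ⟨c₃, c₂, c₁, c₀, hc⟩ : ∃ c₃ c₂ c₁ c₀ : K[X], q = Polynomial.C c₃ * X ^ 3 +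
        Polynomial.C c₂ * X ^ 2 + Polynomial.C c₁ * X + Polynomial.C c₀ := by
      refine ⟨Polynomial.C N.κ * (V 0 + V 1 + V 2 + V 3),
        Polynomial.C N.ζ * X ^ 4 - Polynomial.C N.κ *
          (V 0 * V 1 + V 0 * V 2 + V 0 * V 3 + V 1 * V 2 + V 1 * V 3 + V 2 * V 3),
        X ^ 4 * (Polynomial.C N.δ + Polynomial.C N.ε * X ^ 4) + Polynomial.C N.κ *
          (V 0 * V 1 * V 2 + V 0 * V 1 * V 3 + V 0 * V 2 * V 3 + V 1 * V 2 * V 3),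
        X ^ 4 * (Polynomial.C N.α + Polynomial.C N.β * X ^ 4 + Polynomial.C N.γ * X ^ 8) -
          Polynomial.C N.κ * (V 0 * V 1 * V 2 * V 3), ?_⟩
      simp only [q, NormalForm.form, map_add, map_sub, map_mul, map_pow,
        show ∀ r : K, algebraMap K K[X][X] r = Polynomial.C (Polynomial.C r) from fun _ => rfl]
      ring
    rw [hc]
    compute_degree
  have hq : q = 0 := by
    refine eq_zero_of_natDegree_lt_card_of_eval_eq_zero q hV (fun j => ?_)
      (by rw [Fintype.card_fin]; omega)
    have h1 := N.map_form ((aeval (V j) : K[X][X] →ₐ[K[X]] K[X]).restrictScalars K) 1 X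
      (Polynomial.C (X ^ 4))
    simp only [map_one, AlgHom.restrictScalars_apply, aeval_X, aeval_C, Algebra.algebraMap_self,
      RingHom.id_apply, hVroot, coe_aeval_eq_eval] at h1
    simp only [q, eval_sub, eval_mul, eval_C, eval_X]
    rw [h1]
    fin_cases j <;> simp
  have hfac : ∀ u Y : K, N.form 1 Y (u ^ 4) = N.κ * ((Y - T.W.eval (ξ 0 * u)) *
      (Y - T.W.eval (ξ 1 * u)) * (Y - T.W.eval (ξ 2 * u)) * (Y - T.W.eval (ξ 3 * u))) := by
    intro u Y
    have h1 := congrArg (fun p => (aeval u : K[X] →ₐ[K] K) (Polynomial.eval (Polynomial.C Y) p)) hq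
    have h3 := N.map_form ((aeval u : K[X] →ₐ[K] K).comp
      ((aeval (Polynomial.C Y) : K[X][X] →ₐ[K[X]] K[X]).restrictScalars K)) 1 X
      (Polynomial.C (X ^ 4))
    simp [coe_aeval_eq_eval] at h3
    simp [q, V, coe_aeval_eq_eval, eval_comp] at h1
    rw [← h3]
    exact sub_eq_zero.1 h1
  have h1 : N.form 1 (y / s ^ 4) ((t / s) ^ 4) = 0 := by
    have h' : N.form (s ^ 4) y (t ^ 4) = 0 := by rw [hs, ht]; exact h
    have h3 := N.form_mul (s ^ 4) 1 (y / s ^ 4) ((t / s) ^ 4)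
    rw [mul_one, mul_div_cancel₀ _ (pow_ne_zero 4 hs0), ← mul_pow, mul_div_cancel₀ _ hs0, h'] at h3
    exact (mul_eq_zero.1 h3.symm).resolve_left (pow_ne_zero 4 (pow_ne_zero 4 hs0))
  rw [hfac] at h1
  obtain ⟨j, hj⟩ : ∃ j, y / s ^ 4 = T.W.eval (ξ j * (t / s)) := by
    have h3 := (mul_eq_zero.1 h1).resolve_left N.κ_ne
    simp only [mul_eq_zero, sub_eq_zero, or_assoc] at h3
    rcases h3 with h3 | h3 | h3 | h3 <;> exact ⟨_, h3⟩
  refine ⟨s, ξ j * t, hs.symm, ?_, by rw [mul_pow, hξ4, one_mul, ht]⟩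
  rw [eval_W] at hj
  field_simp at hj
  linear_combination hj

end Param

/-! ### The remaining smooth points -/

theorem coeffs_eq_zero_of_quartic_eq_zero {u₄ u₃ u₂ u₁ u₀ : K}
    (h : Polynomial.C u₄ * X ^ 4 + Polynomial.C u₃ * X ^ 3 + Polynomial.C u₂ * X ^ 2 +
      Polynomial.C u₁ * X + Polynomial.C u₀ = 0) :
    u₄ = 0 ∧ u₃ = 0 ∧ u₂ = 0 ∧ u₁ = 0 ∧ u₀ = 0 := by
  have c (n : ℕ) := congrArg (fun p => p.coeff n) h
  simp only [coeff_add, coeff_C_mul, coeff_X_pow, coeff_X, coeff_C, coeff_zero] at c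
  exact ⟨by simpa using c 4, by simpa using c 3, by simpa using c 2, by simpa using c 1,
    by simpa using c 0⟩

/-- If a polynomial of degree at most four is a square, then its coefficients satisfy two relations,
which result from eliminating the coefficients `s₂`, `s₁`, `s₀` of the square root. -/
theorem relations_of_quartic_eq_sq {A₄ A₃ A₂ A₁ A₀ : K} {S : K[X]}
    (h : Polynomial.C A₄ * X ^ 4 + Polynomial.C A₃ * X ^ 3 + Polynomial.C A₂ * X ^ 2 +
      Polynomial.C A₁ * X + Polynomial.C A₀ = S ^ 2) :
    A₁ ^ 2 * A₄ = A₃ ^ 2 * A₀ ∧ A₃ ^ 3 - 4 * A₄ * A₃ * A₂ + 8 * A₄ ^ 2 * A₁ = 0 := by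
  have hdeg : S.natDegree ≤ 2 := by
    have h1 : (Polynomial.C A₄ * X ^ 4 + Polynomial.C A₃ * X ^ 3 + Polynomial.C A₂ * X ^ 2 +
      Polynomial.C A₁ * X + Polynomial.C A₀).natDegree ≤ 4 := by compute_degree
    rw [h, natDegree_pow] at h1
    omega
  obtain ⟨s₂, s₁, s₀, rfl⟩ : ∃ s₂ s₁ s₀ : K,
      S = Polynomial.C s₂ * X ^ 2 + Polynomial.C s₁ * X + Polynomial.C s₀ := by
    refine ⟨S.coeff 2, S.coeff 1, S.coeff 0, ?_⟩
    conv_lhs => rw [S.as_sum_range_C_mul_X_pow' (Nat.lt_succ_of_le hdeg)]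
    simp [Finset.sum_range_succ]
    ring
  obtain ⟨h₄, h₃, h₂, h₁, h₀⟩ := coeffs_eq_zero_of_quartic_eq_zero (u₄ := A₄ - s₂ ^ 2)
    (u₃ := A₃ - 2 * s₂ * s₁) (u₂ := A₂ - s₁ ^ 2 - 2 * s₂ * s₀) (u₁ := A₁ - 2 * s₁ * s₀)
    (u₀ := A₀ - s₀ ^ 2) (by
      simp only [map_sub, map_mul, map_pow, map_ofNat]
      linear_combination h)
  obtain rfl := sub_eq_zero.1 h₄
  obtain rfl := sub_eq_zero.1 h₃
  obtain rfl := sub_eq_zero.1 h₁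
  obtain rfl := sub_eq_zero.1 h₀
  obtain rfl : A₂ = s₁ ^ 2 + 2 * s₂ * s₀ := by linear_combination h₂
  exact ⟨by ring, by ring⟩

namespace Param

variable {C : PlaneCurve K 4} {b : Module.Basis (Fin 3) K (Fin 3 → K)} (T : Param C b)

/-- For the curve `(1 : k ((X + l)³ - l³) : X⁴)`, a smooth point `(1 : W(r) : r⁴)` with `r ≠ 0` is
the image of one parameter only: two parameters with the same image give linearly independent
tangent directions, on all of which the differential of the equation vanishes. -/
theorem eq_of_isSmoothPoint [IsAlgClosed K] (h2 : (2 : K) ≠ 0) (h3 : (3 : K) ≠ 0)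
    (N : NormalForm C b) {k l : K} (hk : k ≠ 0) (hl : l ≠ 0)
    (e₁ : T.w₁ = 3 * k * l ^ 2) (e₂ : T.w₂ = 3 * k * l) (e₃ : T.w₃ = k)
    {P : Plane K} {x r u : K} (hr : r ≠ 0) (hP0 : b.repr P.rep 0 = x)
    (hP1 : b.repr P.rep 1 = x * T.W.eval r) (hP2 : b.repr P.rep 2 = x * r ^ 4)
    (hP : C.IsSmoothPoint P) (hu : u ^ 4 = r ^ 4) (hWu : T.W.eval u = T.W.eval r) : u = r := by
  by_contra hur
  set Y := T.W.eval r with hY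
  set Z := r ^ 4 with hZ
  set Φy := 4 * N.κ * Y ^ 3 + Z * (N.δ + N.ε * Z + 2 * N.ζ * Y) with hΦy
  set Φz := N.α + 2 * N.β * Z + 3 * N.γ * Z ^ 2 + N.δ * Y + 2 * N.ε * Y * Z + N.ζ * Y ^ 2 with hΦz
  have hder : ∀ v : K, T.W.eval v = Y → v ^ 4 = Z →
      Φy * (3 * k * (v + l) ^ 2) + Φz * (4 * v ^ 3) = 0 := by
    intro v hv hv4
    have h := congrArg (fun p => (derivative p).eval v) (T.form_W N)
    simp only [NormalForm.form, algebraMap_eq, derivative_add, derivative_mul, derivative_C,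
      derivative_pow, derivative_X, derivative_one, eval_add, eval_mul, eval_C, eval_pow, eval_X,
      eval_one, eval_zero, derivative_zero, hv, hv4] at h
    have hW' : (derivative T.W).eval v = 3 * k * (v + l) ^ 2 := by
      simp [W, e₁, e₂, e₃, derivative_pow]
      ring
    rw [hW'] at h
    rw [hΦy, hΦz]
    have h' : v ^ (4 - 1) = v ^ 3 := rfl
    rw [h'] at h
    push_cast at h
    linear_combination h
  have hr' := hder r rfl rfl
  have hu' := hder u hWu hu
  -- the tangent directions at the two parameters are independent: `u = -r` or `u = j r` with
  -- `j² = -1`, and in both cases dependence contradicts `W(u) = W(r)`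
  have hdet : (r + l) ^ 2 * u ^ 3 - (u + l) ^ 2 * r ^ 3 ≠ 0 := by
    intro hdet
    have hWdiff : u ^ 2 + u * r + r ^ 2 + 3 * l * (u + r) + 3 * l ^ 2 = 0 := by
      have h : k * (u - r) * (u ^ 2 + u * r + r ^ 2 + 3 * l * (u + r) + 3 * l ^ 2) = 0 := by
        rw [hY, eval_W, eval_W, e₁, e₂, e₃] at hWu
        linear_combination hWu
      exact (mul_eq_zero.1 h).resolve_left (mul_ne_zero hk (sub_ne_zero.2 hur))
    have hul : (u + r) * (u ^ 2 + r ^ 2) = 0 := by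
      refine (mul_eq_zero.1 (?_ : (u - r) * ((u + r) * (u ^ 2 + r ^ 2)) = 0)).resolve_left
        (sub_ne_zero.2 hur)
      linear_combination hu
    rcases mul_eq_zero.1 hul with h | h
    · obtain rfl : u = -r := eq_neg_of_add_eq_zero_left h
      have h4 : 2 ^ 2 * r ^ 3 * l ^ 2 = 0 := by
        linear_combination hdet + 2 * r ^ 3 * hWdiff
      exact mul_ne_zero (mul_ne_zero (pow_ne_zero 2 h2) (pow_ne_zero 3 hr)) (pow_ne_zero 2 hl) h4
    · obtain ⟨i, hi⟩ := IsAlgClosed.exists_pow_nat_eq (-1 : K) (n := 2) (by norm_num)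
      obtain ⟨j, hj, rfl⟩ : ∃ j : K, j ^ 2 = -1 ∧ u = j * r := by
        have h4 : (u - i * r) * (u + i * r) = 0 := by linear_combination h - r ^ 2 * hi
        rcases mul_eq_zero.1 h4 with h4 | h4
        · exact ⟨i, hi, sub_eq_zero.1 h4⟩
        · exact ⟨-i, by rw [neg_sq, hi], by linear_combination h4⟩
      have hE1 : r ^ 2 * (1 + j) + 4 * l * r + (1 - j) * l ^ 2 = 0 := by
        apply mul_left_cancel₀ (pow_ne_zero 3 hr)
        linear_combination j * hdet -
          ((r + l) ^ 2 * r ^ 3 * (j ^ 2 - 1) - (r ^ 3) * (j * r ^ 2 + 2 * r * l)) * hj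
      have hE2 : j * r ^ 2 + 3 * l * r * (1 + j) + 3 * l ^ 2 = 0 := by
        linear_combination hWdiff - r ^ 2 * hj
      have hE3 : r = -(1 - j) * l := by
        have h4 : 2 * l * (r + (1 - j) * l) = 0 := by
          linear_combination (1 - j) * hE2 - hE1 + (r ^ 2 + 3 * l * r) * hj
        have h5 := (mul_eq_zero.1 h4).resolve_left (mul_ne_zero h2 hl)
        linear_combination h5
      have h4 : l ^ 2 = 0 := by
        rw [hE3] at hE2
        linear_combination -hE2 + (j - 2 + 3) * l ^ 2 * hj
      exact pow_ne_zero 2 hl h4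
  have hΦy0 : Φy = 0 := by
    have h : 3 * k * ((r + l) ^ 2 * u ^ 3 - (u + l) ^ 2 * r ^ 3) * Φy = 0 := by
      linear_combination u ^ 3 * hr' - r ^ 3 * hu'
    exact (mul_eq_zero.1 h).resolve_left (mul_ne_zero (mul_ne_zero h3 hk) hdet)
  have hΦz0 : Φz = 0 := by
    rw [hΦy0, zero_mul, zero_add] at hr'
    refine (mul_eq_zero.1 hr').resolve_right (mul_ne_zero ?_ (pow_ne_zero 3 hr))
    rw [show (4 : K) = 2 * 2 by norm_num]
    exact mul_ne_zero h2 h2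
  -- the remaining partial derivative vanishes by Euler's formula
  have hΦx0 : Z * (3 * N.α + 2 * N.β * Z + N.γ * Z ^ 2 + 2 * N.δ * Y + N.ε * Y * Z +
      N.ζ * Y ^ 2) = 0 := by
    have h := T.form_eval N r
    simp only [NormalForm.form, Algebra.algebraMap_self, RingHom.id_apply, ← hY, ← hZ] at h
    linear_combination 4 * h - Y * (hΦy.symm.trans hΦy0) - Z * (hΦz.symm.trans hΦz0)
  apply hP.2
  refine LinearMap.ext fun w => ?_
  rw [N.differential_apply P hP0 hP1 hP2, LinearMap.zero_apply]
  linear_combination x ^ 3 * b.repr w 0 * hΦx0 + x ^ 3 * b.repr w 1 * (hΦy.symm.trans hΦy0) +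
    x ^ 3 * b.repr w 2 * (hΦz.symm.trans hΦz0)

/-- On the curve `(1 : k ((X + l)³ - l³) : X⁴)`, no smooth point `(1 : W(r) : r⁴)` with `r ≠ 0` is a
Galois point. The projection from it is `X ↦ N / (k D)` with
`N = (X⁴ - r⁴) / (X - r)` and `k D = (W - W(r)) / (X - r)`. If it were Galois, then the discriminant
of the Bézoutian of `N` and `D`, a polynomial of degree four, would be a square. The relations
between its coefficients exclude all `r` but those of the double points. -/
theorem not_isInnerGalois [IsAlgClosed K] (h2 : (2 : K) ≠ 0) (h3 : (3 : K) ≠ 0)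
    (N : NormalForm C b) {k l : K} (hk : k ≠ 0) (hl : l ≠ 0)
    (e₁ : T.w₁ = 3 * k * l ^ 2) (e₂ : T.w₂ = 3 * k * l) (e₃ : T.w₃ = k)
    {P : Plane K} {x r : K} (hx : x ≠ 0) (hr : r ≠ 0) (hP0 : b.repr P.rep 0 = x)
    (hP1 : b.repr P.rep 1 = x * T.W.eval r) (hP2 : b.repr P.rep 2 = x * r ^ 4)
    (hP : C.IsSmoothPoint P) : ¬ C.IsInnerGalois P := by
  intro hG
  have hinj : ∀ u : K, u ^ 4 = r ^ 4 → T.W.eval u = T.W.eval r → u = r := fun u =>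
    T.eq_of_isSmoothPoint h2 h3 N hk hl e₁ e₂ e₃ hr hP0 hP1 hP2 hP
  set n : K[X] := X ^ 3 + Polynomial.C r * X ^ 2 + Polynomial.C (r ^ 2) * X +
    Polynomial.C (r ^ 3) with hn
  set D : K[X] := Polynomial.C k * (X ^ 2 + Polynomial.C (r + 3 * l) * X +
    Polynomial.C (r ^ 2 + 3 * l * r + 3 * l ^ 2)) with hD
  have hnum : T.lin ![-r ^ 4, 0, 1] = (X - Polynomial.C r) * n := by
    simp only [lin, hn, Matrix.cons_val_zero, Matrix.cons_val_one, Matrix.cons_val, C_0, C_1,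
      C_neg, C_pow]
    ring
  have hden : T.lin ![-T.W.eval r, 1, 0] = (X - Polynomial.C r) * D := by
    rw [eval_W]
    simp only [lin, hD, Matrix.cons_val_zero, Matrix.cons_val_one, Matrix.cons_val, C_0, C_1,
      C_neg, e₁, e₂, e₃, W, C_add, C_mul, C_pow, map_ofNat]
    ring
  have hDdeg : D.natDegree = 2 := by
    rw [hD, natDegree_C_mul hk]
    compute_degree!
  have hndeg : n.natDegree = 3 := by
    rw [hn]
    compute_degree!
  have hD0 : D ≠ 0 := by rintro h; rw [h] at hDdeg; simp at hDdeg
  have hcop : IsCoprime n D := by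
    rw [Polynomial.isCoprime_iff_aeval_ne_zero_of_isAlgClosed K K]
    intro u
    by_contra! h
    obtain ⟨hu1, hu2⟩ := h
    rw [coe_aeval_eq_eval] at hu1 hu2
    have hu4 : u ^ 4 = r ^ 4 := by
      have := congrArg (Polynomial.eval u) hnum
      rw [eval_mul, hu1, mul_zero] at this
      simp [lin] at this
      linear_combination this
    have huW : T.W.eval u = T.W.eval r := by
      have := congrArg (Polynomial.eval u) hden
      rw [eval_mul, hu2, mul_zero] at this
      simp [lin] at this
      linear_combination this
    rw [hinj u hu4 huW, hn] at hu1
    simp at hu1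
    have : 2 ^ 2 * r ^ 3 = 0 := by linear_combination hu1
    exact mul_ne_zero (pow_ne_zero 2 h2) (pow_ne_zero 3 hr) this
  have hG' : IsGalois K⟮(algebraMap K[X] (RatFunc K) n / algebraMap K[X] (RatFunc K) D)⟯
      (RatFunc K) := by
    have e : algebraMap K[X] (RatFunc K) n / algebraMap K[X] (RatFunc K) D =
        algebraMap K[X] (RatFunc K) (T.lin ![-r ^ 4, 0, 1]) /
        algebraMap K[X] (RatFunc K) (T.lin ![-T.W.eval r, 1, 0]) := by
      rw [hnum, hden, map_mul _ (X - Polynomial.C r) n, map_mul _ (X - Polynomial.C r) D]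
      exact (mul_div_mul_left _ _ (RatFunc.algebraMap_ne_zero (X_sub_C_ne_zero r))).symm
    rw [e]
    refine (T.isInnerGalois_iff hP.1 ?_ ?_ ?_ ?_).1 hG
    · intro h
      have := congrFun h 1
      simp at this
    · simp [hP0, hP2]
      ring
    · simp [hP0, hP1]
      ring
    · intro q hq
      refine ⟨q 2, q 1, fun i => ?_⟩
      rw [hP0, hP1, hP2] at hq
      have h0 : q 0 = -(q 2 * r ^ 4) - q 1 * T.W.eval r := by
        apply mul_left_cancel₀ hx
        linear_combination hq
      fin_cases i
      · simp [h0]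
        ring
      · simp
      · simp
  obtain ⟨S, hS⟩ := exists_discrim_eq_sq_of_isGalois (N := n) (D := D) (B₂ := D)
    (B₁ := Polynomial.C k * (Polynomial.C (r + 3 * l) * X ^ 2 +
      Polynomial.C (r ^ 2 + 6 * l * r + 3 * l ^ 2) * X + Polynomial.C (3 * l * r * (r + l))))
    (B₀ := Polynomial.C k * (Polynomial.C (r ^ 2 + 3 * l * r + 3 * l ^ 2) * X ^ 2 +
      Polynomial.C (3 * l * r * (r + l)) * X + Polynomial.C (3 * l ^ 2 * r ^ 2)))
    hcop hD0 (by rw [hndeg, hDdeg]; rfl)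
    (by
      simp only [hn, hD, Polynomial.map_add, Polynomial.map_mul, Polynomial.map_pow,
        Polynomial.map_C, Polynomial.map_X, Polynomial.map_ofNat, C_add, C_mul, C_pow, map_ofNat]
      ring) hD0 hG'
  have hkk : Polynomial.C k⁻¹ * Polynomial.C k = 1 := by rw [← C_mul, inv_mul_cancel₀ hk, C_1]
  obtain ⟨R1, R2⟩ := relations_of_quartic_eq_sq (S := Polynomial.C k⁻¹ * S)
    (A₄ := -3 * (r + l) ^ 2)
    (A₃ := -2 * (r ^ 3 + 9 * l * r ^ 2 + 9 * l ^ 2 * r + 9 * l ^ 3))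
    (A₂ := (r ^ 2 + 6 * l * r + 3 * l ^ 2) ^ 2 - 6 * l * (r + 3 * l) * r * (r + l) -
      12 * l ^ 2 * r ^ 2 - 4 * (r ^ 2 + 3 * l * r + 3 * l ^ 2) ^ 2)
    (A₁ := -6 * l * r * (r ^ 3 + 3 * l * r ^ 2 + 9 * l ^ 2 * r + 3 * l ^ 3))
    (A₀ := -3 * l ^ 2 * r ^ 2 * (r + 3 * l) ^ 2) (by
      rw [mul_pow, ← hS, discrim, hD]
      simp only [C_add, C_mul, C_pow, C_sub, C_neg, map_ofNat]
      generalize Polynomial.C k⁻¹ = k' at hkk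
      generalize Polynomial.C k = k'' at hkk ⊢
      have hkk2 : k' ^ 2 * k'' ^ 2 = 1 := by rw [← mul_pow, hkk, one_pow]
      have hkey : ∀ a₂ a₁ a₀ : K[X], k' ^ 2 * ((k'' * a₁) ^ 2 - 4 * (k'' * a₂) * (k'' * a₀)) =
          a₁ ^ 2 - 4 * a₂ * a₀ := by
        intro a₂ a₁ a₀
        linear_combination (a₁ ^ 2 - 4 * a₂ * a₀) * hkk2
      rw [hkey]
      ring)
  have h23 : (2 ^ 2 * 3 * (l * r) ^ 2 : K) ≠ 0 :=
    mul_ne_zero (mul_ne_zero (pow_ne_zero 2 h2) h3) (pow_ne_zero 2 (mul_ne_zero hl hr))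
  -- the first relation leaves the roots of two quartic polynomials in `r / l`
  have hfac : (2 * ((r ^ 2 - 3 * l ^ 2) * (r ^ 2 + 3 * l ^ 2))) *
      (2 ^ 2 * (r ^ 4 + 6 * r ^ 3 * l + 18 * r ^ 2 * l ^ 2 + 18 * r * l ^ 3 + 9 * l ^ 4)) = 0 := by
    apply mul_left_cancel₀ h23
    linear_combination -R1
  rcases mul_eq_zero.1 hfac with h | h
  · rcases mul_eq_zero.1 ((mul_eq_zero.1 h).resolve_left h2) with h4 | h4
    · -- here the second relation fails
      have hr2 : r ^ 2 = 3 * l ^ 2 := sub_eq_zero.1 h4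
      have h5 : 2 ^ 9 * 3 ^ 5 * l ^ 8 * (5 * l + 3 * r) = 0 := by
        grind
      have h6 := (mul_eq_zero.1 h5).resolve_left (mul_ne_zero (mul_ne_zero
        (pow_ne_zero 9 h2) (pow_ne_zero 5 h3)) (pow_ne_zero 8 hl))
      have h7 : 2 * l ^ 2 = 0 := by
        linear_combination -(5 * l - 3 * r) * h6 - 9 * hr2
      exact mul_ne_zero h2 (pow_ne_zero 2 hl) h7
    · -- the double point with parameters `r` and `-r`
      have h5 := hinj (-r) (by ring) (by
        rw [eval_W, eval_W, e₁, e₂, e₃]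
        linear_combination (-2 * k * r) * h4)
      exact mul_ne_zero h2 hr (by linear_combination -h5)
  · obtain ⟨i, hi⟩ := IsAlgClosed.exists_pow_nat_eq (-1 : K) (n := 2) (by norm_num)
    have h4 : (r ^ 2 + 3 * (1 - i) * l * r - 3 * i * l ^ 2) *
        (r ^ 2 + 3 * (1 + i) * l * r + 3 * i * l ^ 2) = 0 := by
      have h5 := (mul_eq_zero.1 h).resolve_left (pow_ne_zero 2 h2)
      linear_combination h5 - 9 * (l * r + l ^ 2) ^ 2 * hi
    -- the double points with parameters `r` and `j r`, where `j² = -1`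
    obtain ⟨j, hj, hjr⟩ : ∃ j : K, j ^ 2 = -1 ∧
        r ^ 2 + 3 * (1 - j) * l * r - 3 * j * l ^ 2 = 0 := by
      rcases mul_eq_zero.1 h4 with h5 | h5
      · exact ⟨i, hi, h5⟩
      · exact ⟨-i, by rw [neg_sq, hi], by linear_combination h5⟩
    have h5 := hinj (j * r) (by linear_combination r ^ 4 * (j ^ 2 - 1) * hj) (by
      rw [eval_W, eval_W, e₁, e₂, e₃]
      linear_combination (k * r * (j - 1) * j) * hjr +
        (k * r * (j - 1)) * (r ^ 2 + 3 * l * r + 3 * l ^ 2) * hj)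
    have h6 : j = 1 := mul_right_cancel₀ hr (by rw [h5, one_mul])
    rw [h6] at hj
    exact h2 (by linear_combination hj)

end Param

/-! ### The normal form from two hyperflexes -/

/-- The general ternary quartic form, with coefficient `a i j` at `x ^ i * y ^ j * z ^ (4 - i - j)`.
The coefficients with `i + j > 4` do not occur. -/
def quarticSum (a : ℕ → ℕ → K) {A : Type*} [CommRing A] [Algebra K A] (x y z : A) : A :=
  ∑ i ∈ Finset.range 5, ∑ j ∈ Finset.range (5 - i),
    algebraMap K A (a i j) * x ^ i * y ^ j * z ^ (4 - i - j)

theorem map_quarticSum (a : ℕ → ℕ → K) {A B : Type*} [CommRing A] [Algebra K A] [CommRing B]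
    [Algebra K B] (φ : A →ₐ[K] B) (x y z : A) :
    φ (quarticSum a x y z) = quarticSum a (φ x) (φ y) (φ z) := by
  simp [quarticSum]

theorem exists_poly_eq_quarticSum (C : PlaneCurve K 4)
    (b : Module.Basis (Fin 3) K (Fin 3 → K)) :
    ∃ a : ℕ → ℕ → K, C.poly = quarticSum a (coordForm b 0) (coordForm b 1) (coordForm b 2) := by
  obtain ⟨a, ha⟩ := exists_expansion (inCoords_isHomogeneous b C.isHomogeneous)
  refine ⟨a, ?_⟩
  conv_lhs => rw [← aeval_coordForm_inCoords b C.poly, ha]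
  simp [quarticSum]

theorem nonempty_normalForm {C : PlaneCurve K 4} {b : Module.Basis (Fin 3) K (Fin 3 → K)}
    {a : ℕ → ℕ → K}
    (ha : C.poly = quarticSum a (coordForm b 0) (coordForm b 1) (coordForm b 2))
    (h00 : a 0 0 = 0) (h01 : a 0 1 = 0) (h02 : a 0 2 = 0) (h03 : a 0 3 = 0)
    (h40 : a 4 0 = 0) (h31 : a 3 1 = 0) (h22 : a 2 2 = 0) (h13 : a 1 3 = 0)
    (h04 : a 0 4 ≠ 0) (h30 : a 3 0 ≠ 0) (h10 : a 1 0 ≠ 0) : Nonempty (NormalForm C b) := by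
  refine ⟨⟨a 0 4, a 3 0, a 2 0, a 1 0, a 2 1, a 1 1, a 1 2, h04, h30, h10, ?_⟩⟩
  rw [ha]
  simp [quarticSum, Finset.sum_range_succ, h00, h01, h02, h03, h40, h31, h22, h13]
  ring

namespace PlaneCurve

theorem restrictToLine_eq_quarticSum {C : PlaneCurve K 4}
    {b : Module.Basis (Fin 3) K (Fin 3 → K)} {a : ℕ → ℕ → K}
    (ha : C.poly = quarticSum a (coordForm b 0) (coordForm b 1) (coordForm b 2))
    (v w : Fin 3 → K) : C.restrictToLine v w =
    quarticSum a (Polynomial.C (b.repr v 0) + X * Polynomial.C (b.repr w 0))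
      (Polynomial.C (b.repr v 1) + X * Polynomial.C (b.repr w 1))
      (Polynomial.C (b.repr v 2) + X * Polynomial.C (b.repr w 2)) := by
  rw [restrictToLine, ha, map_quarticSum, aeval_line_coordForm, aeval_line_coordForm,
    aeval_line_coordForm]

/-- Contact of order four with the tangent line at `(0 : 0 : 1)`, the tangent line being spanned by
the last two basis vectors, in terms of the coefficients of the equation. -/
theorem coeffs_of_hyperflex {C : PlaneCurve K 4}
    {b : Module.Basis (Fin 3) K (Fin 3 → K)} {a : ℕ → ℕ → K}
    (ha : C.poly = quarticSum a (coordForm b 0) (coordForm b 1) (coordForm b 2))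
    {P : Plane K} (hP : P = Projectivization.mk K (b 2) (b.ne_zero 2)) (hs : C.IsSmoothPoint P)
    (hI : C.intersectionMultiplicity P (C.tangentLine P) = 4) (hb : b 1 ∈ C.tangentLine P) :
    a 0 0 = 0 ∧ a 0 1 = 0 ∧ a 0 2 = 0 ∧ a 0 3 = 0 ∧ a 0 4 ≠ 0 ∧ a 1 0 ≠ 0 := by
  obtain ⟨r, hr, hrep⟩ := NormalForm.repr_of_rep (b := b) hP
  have h0 : b.repr P.rep 0 = 0 := by simp [hrep]
  have h1 : b.repr P.rep 1 = 0 := by simp [hrep]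
  have h2 : b.repr P.rep 2 = r := by simp [hrep]
  have hbP : b 1 ∉ P.submodule := by
    rw [hP, Projectivization.submodule_mk, Submodule.mem_span_singleton]
    rintro ⟨c, hc⟩
    have := congrArg (fun v => b.repr v 1) hc
    simp at this
  have hline : C.restrictToLine P.rep (b 1) =
      Polynomial.C (a 0 4) * X ^ 4 + Polynomial.C (a 0 3 * r) * X ^ 3 +
      Polynomial.C (a 0 2 * r ^ 2) * X ^ 2 + Polynomial.C (a 0 1 * r ^ 3) * X +
      Polynomial.C (a 0 0 * r ^ 4) := by
    rw [restrictToLine_eq_quarticSum ha, h0, h1, h2]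
    simp [quarticSum, Finset.sum_range_succ]
    ring
  have hmul : ∀ w ∈ C.tangentLine P, w ∉ P.submodule →
      X ^ 4 ∣ C.restrictToLine P.rep w := by
    intro w hw hwP
    rw [pow_dvd_iff_le_emultiplicity]
    have h : C.intersectionMultiplicity P (C.tangentLine P) ≤
        emultiplicity X (C.restrictToLine P.rep w) := iInf₂_le w ⟨hw, hwP⟩
    rw [hI] at h
    exact h
  have hdvd := X_pow_dvd_iff.1 (hmul _ hb hbP)
  rw [hline] at hdvd
  have e0 : a 0 0 = 0 := by
    have h := hdvd 0 (by norm_num)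
    simpa [coeff_X, hr, -map_mul, -map_pow] using h
  have e1 : a 0 1 = 0 := by
    have h := hdvd 1 (by norm_num)
    simpa [coeff_X, coeff_C, coeff_X_pow, hr, e0, -map_mul, -map_pow] using h
  have e2 : a 0 2 = 0 := by
    have h := hdvd 2 (by norm_num)
    simpa [coeff_X, coeff_C, coeff_X_pow, hr, e0, e1, -map_mul, -map_pow] using h
  have e3 : a 0 3 = 0 := by
    have h := hdvd 3 (by norm_num)
    simpa [coeff_X, coeff_C, coeff_X_pow, hr, e0, e1, e2, -map_mul, -map_pow] using h
  have hd : ∀ w, C.differential P w = a 1 0 * r ^ 3 * b.repr w 0 := by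
    intro w
    rw [C.differential_apply, coeff_one_eq_eval_derivative, restrictToLine_eq_quarticSum ha, h0,
      h1, h2]
    simp [quarticSum, Finset.sum_range_succ, derivative_pow, e0, e1]
    ring
  have h10 : a 1 0 ≠ 0 := by
    intro h10
    exact hs.2 (LinearMap.ext fun w => by rw [hd, h10]; simp)
  refine ⟨e0, e1, e2, e3, ?_, h10⟩
  -- if the coefficient of `y⁴` vanished, the tangent line would be a component of the curve
  intro e4
  have hle : (5 : ℕ∞) ≤ C.intersectionMultiplicity P (C.tangentLine P) := by
    refine le_iInf₂ fun w hw => ?_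
    have hw0 : b.repr w 0 = 0 := by
      have h := hw.1
      rw [tangentLine, LinearMap.mem_ker, hd] at h
      exact (mul_eq_zero.1 h).resolve_left (mul_ne_zero h10 (pow_ne_zero 3 hr))
    have : C.restrictToLine P.rep w = 0 := by
      rw [restrictToLine_eq_quarticSum ha, h0, hw0]
      simp [quarticSum, Finset.sum_range_succ, e0, e1, e2, e3, e4]
    rw [this, emultiplicity_zero]
    exact le_top
  rw [hI] at hle
  exact absurd hle (by decide)

end PlaneCurve

/-- A basis consisting of a vector outside the kernel of a linear form, and two independent vectors
in the kernel. -/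
theorem exists_basis {d : (Fin 3 → K) →ₗ[K] K} {v₀ v₁ v₂ : Fin 3 → K} (h₀ : d v₀ ≠ 0)
    (h₁ : d v₁ = 0) (h₂ : d v₂ = 0) (h : LinearIndependent K ![v₁, v₂]) :
    ∃ b : Module.Basis (Fin 3) K (Fin 3 → K), b 0 = v₀ ∧ b 1 = v₁ ∧ b 2 = v₂ := by
  have hli : LinearIndependent K ![v₀, v₁, v₂] := by
    refine linearIndependent_finCons.2 ⟨h, fun hmem => h₀ ?_⟩
    have hle : Submodule.span K (Set.range ![v₁, v₂]) ≤ LinearMap.ker d := by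
      rw [Submodule.span_le]
      rintro _ ⟨i, rfl⟩
      fin_cases i
      · exact h₁
      · exact h₂
    exact hle hmem
  refine ⟨basisOfLinearIndependentOfCardEqFinrank hli (by simp), ?_, ?_, ?_⟩ <;> simp

namespace PlaneCurve

variable {C : PlaneCurve K 4}

theorem rep_mem_tangentLine {P : Plane K} (hP : P ∈ C.points) : P.rep ∈ C.tangentLine P := by
  have h : C.restrictToLine P.rep P.rep = (1 + X) ^ 4 *
      MvPolynomial.aeval (fun i => Polynomial.C (P.rep i)) C.poly := by
    rw [restrictToLine, ← aeval_smul_of_isHomogeneous C.isHomogeneous]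
    congr 2
    ext1 i
    ring
  have h0 : MvPolynomial.aeval (fun i => Polynomial.C (P.rep i)) C.poly = (0 : K[X]) := by
    have h1 := MvPolynomial.map_aeval P.rep (Polynomial.C : K →+* K[X]) C.poly
    have hP' : MvPolynomial.aeval P.rep C.poly = 0 := hP
    rw [hP', map_zero] at h1
    exact h1.symm
  rw [mem_tangentLine, h, h0, mul_zero, coeff_zero]

/-- The tangent line at a smooth point with contact of order four meets the curve nowhere else. -/
theorem rep_notMem_tangentLine {P Q : Plane K} (hs : C.IsSmoothPoint P)
    (hI : C.intersectionMultiplicity P (C.tangentLine P) = 4) (hQ : Q ∈ C.points) (hPQ : P ≠ Q) :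
    Q.rep ∉ C.tangentLine P := by
  intro hmem
  obtain ⟨v₀, hv₀⟩ : ∃ v, C.differential P v ≠ 0 := by
    by_contra! h
    exact hs.2 (LinearMap.ext h)
  have hli : LinearIndependent K ![Q.rep, P.rep] := by
    rw [LinearIndependent.pair_iff' Q.rep_nonzero]
    intro c hc
    apply hPQ
    rw [← P.mk_rep, ← Q.mk_rep, Projectivization.mk_eq_mk_iff']
    exact ⟨c, hc⟩
  obtain ⟨b, hb0, hb1, hb2⟩ := exists_basis hv₀ hmem (rep_mem_tangentLine hs.1) hli
  obtain ⟨a, ha⟩ := exists_poly_eq_quarticSum C b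
  have hP : P = Projectivization.mk K (b 2) (b.ne_zero 2) := by
    simp only [hb2, Projectivization.mk_rep]
  obtain ⟨-, -, -, -, h04, -⟩ := coeffs_of_hyperflex ha hP hs hI (hb1 ▸ hmem)
  apply h04
  have h1 : MvPolynomial.aeval Q.rep C.poly = 0 := hQ
  rw [ha, map_quarticSum] at h1
  simp only [MvPolynomial.aeval_eq_eval] at h1
  rw [← hb1, eval_coordForm, eval_coordForm, eval_coordForm] at h1
  simpa [quarticSum, Finset.sum_range_succ] using h1

/-- The basis consists of representatives of one of the two points, of the intersection of the two
tangent lines, and of the other point. -/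
theorem exists_normalForm_of_two_le_deltaTwo (h : 2 ≤ C.deltaTwo) :
    ∃ b : Module.Basis (Fin 3) K (Fin 3 → K), Nonempty (NormalForm C b) ∧
      C.IsInnerGalois (Projectivization.mk K (b 2) (b.ne_zero 2)) := by
  obtain ⟨P, Q, ⟨hPs, hPG, hPI⟩, ⟨hQs, hQG, hQI⟩, hPQ⟩ :=
    Set.one_lt_encard_iff.1 (lt_of_lt_of_le (by decide : (1 : ℕ∞) < 2) h)
  have hQP := rep_notMem_tangentLine hPs hPI hQs.1 hPQ
  have hPQ' := rep_notMem_tangentLine hQs hQI hPs.1 hPQ.symm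
  obtain ⟨v, hv, hv0⟩ := Submodule.exists_mem_ne_zero_of_ne_bot
    (LinearMap.ker_ne_bot_of_finrank_lt
      (f := (C.differential P).prod (C.differential Q)) (by simp))
  rw [LinearMap.mem_ker, LinearMap.prod_apply, Function.prod_apply, Prod.mk_eq_zero] at hv
  obtain ⟨hvP, hvQ⟩ := hv
  have hli : LinearIndependent K ![v, P.rep] := by
    rw [LinearIndependent.pair_iff' hv0]
    intro c hc
    exact hPQ' (hc ▸ Submodule.smul_mem _ c hvQ)
  obtain ⟨b, hb0, hb1, hb2⟩ := exists_basis (d := C.differential P) hQP hvP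
    (rep_mem_tangentLine hPs.1) hli
  have hP : P = Projectivization.mk K (b 2) (b.ne_zero 2) := by
    simp only [hb2, Projectivization.mk_rep]
  obtain ⟨a, ha⟩ := exists_poly_eq_quarticSum C b
  obtain ⟨h00, h01, h02, h03, h04, h10⟩ := coeffs_of_hyperflex ha hP hPs hPI (hb1 ▸ hvP)
  -- the same in the coordinates with `x` and `z` exchanged
  have hform : ∀ i, coordForm (b.reindex (Equiv.swap 0 2)) i = coordForm b (Equiv.swap 0 2 i) := by
    intro i
    simp [coordForm]
  have ha' : C.poly = quarticSum (fun i j => a (4 - i - j) j)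
      (coordForm (b.reindex (Equiv.swap 0 2)) 0) (coordForm (b.reindex (Equiv.swap 0 2)) 1)
      (coordForm (b.reindex (Equiv.swap 0 2)) 2) := by
    rw [hform, hform, hform, ha]
    simp only [Equiv.swap_apply_left, Equiv.swap_apply_right,
      show (Equiv.swap 0 2 : Equiv.Perm (Fin 3)) 1 = 1 from rfl]
    simp [quarticSum, Finset.sum_range_succ]
    ring
  have hQ : Q = Projectivization.mk K (b.reindex (Equiv.swap 0 2) 2)
      ((b.reindex (Equiv.swap 0 2)).ne_zero 2) := by
    simp [hb0]
  obtain ⟨h40, h31, h22, h13, -, h30⟩ := coeffs_of_hyperflex ha' hQ hQs hQI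
    (by
      have h1 : b.reindex (Equiv.swap 0 2) 1 = v := (b.reindex_apply _ _).trans hb1
      rw [h1]
      exact hvQ)
  exact ⟨b, nonempty_normalForm ha h00 h01 h02 h03 h40 h31 h22 h13 h04 h30 h10, hP ▸ hPG⟩

end PlaneCurve

/-! ### The quartic `(s⁴ : s (s + t)³ : t⁴)` -/

/-- The change of coordinates `(x : y : z) ↦ (l⁴ x : l⁴ x + (l / k) y : z)`. It takes
`(1 : k ((u + l)³ - l³) : u⁴)` to `(l⁴ : l (l + u)³ : u⁴)`. -/
def shear {k l : K} (hk : k ≠ 0) (hl : l ≠ 0) : (Fin 3 → K) ≃ₗ[K] (Fin 3 → K) where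
  toFun v := ![l ^ 4 * v 0, l ^ 4 * v 0 + l / k * v 1, v 2]
  invFun v := ![v 0 / l ^ 4, k / l * (v 1 - v 0), v 2]
  map_add' v w := by
    ext i
    fin_cases i <;> simp <;> ring
  map_smul' c v := by
    ext i
    fin_cases i <;> simp <;> ring
  left_inv v := by
    ext i
    fin_cases i <;> simp <;> field_simp
  right_inv v := by
    ext i
    fin_cases i <;> simp <;> field_simp
    ring

theorem eval_smul_poly (C : PlaneCurve K 4) (c : K) (v : Fin 3 → K) :
    MvPolynomial.eval (c • v) C.poly = c ^ 4 * MvPolynomial.eval v C.poly := by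
  have := aeval_smul_of_isHomogeneous C.isHomogeneous c v
  simpa [MvPolynomial.aeval_eq_eval] using! this

theorem mk_mem_points (C : PlaneCurve K 4) {v : Fin 3 → K} (hv : v ≠ 0) :
    Projectivization.mk K v hv ∈ C.points ↔ MvPolynomial.eval v C.poly = 0 := by
  obtain ⟨a, ha⟩ := Projectivization.exists_smul_eq_mk_rep K v hv
  change MvPolynomial.eval (Projectivization.mk K v hv).rep C.poly = 0 ↔ _
  rw [← ha, Units.smul_def, eval_smul_poly, mul_eq_zero,
    or_iff_right (pow_ne_zero 4 a.ne_zero)]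

theorem quarticMorphism_mk {v : Fin 2 → K} (hv : v ≠ 0) :
    quarticMorphism K (Projectivization.mk K v hv) =
      Projectivization.mk K (quarticForms v) (quarticForms_ne_zero hv) := rfl

namespace NormalForm

variable {C : PlaneCurve K 4} {b : Module.Basis (Fin 3) K (Fin 3 → K)}

theorem eval_poly (N : NormalForm C b) (v : Fin 3 → K) :
    MvPolynomial.eval v C.poly = N.form (b.repr v 0) (b.repr v 1) (b.repr v 2) := by
  have h : MvPolynomial.eval v C.poly = N.form (MvPolynomial.eval v (coordForm b 0))
      (MvPolynomial.eval v (coordForm b 1)) (MvPolynomial.eval v (coordForm b 2)) :=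
    N.map_poly (MvPolynomial.aeval v)
  simpa only [eval_coordForm] using h

end NormalForm

namespace Param

variable {C : PlaneCurve K 4} {b : Module.Basis (Fin 3) K (Fin 3 → K)} (T : Param C b)

/-- If `w₂² = 3 w₁ w₃`, then the smooth Galois points are the two hyperflexes of the normal form. -/
theorem setOf_isSmoothPoint_isInnerGalois [IsAlgClosed K] (h2 : (2 : K) ≠ 0) (h3 : (3 : K) ≠ 0)
    (N : NormalForm C b) (hw : T.w₂ ^ 2 = 3 * T.w₁ * T.w₃) :
    {P : Plane K | C.IsSmoothPoint P ∧ C.IsInnerGalois P} =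
      {Projectivization.mk K (b 2) (b.ne_zero 2), Projectivization.mk K (b 0) (b.ne_zero 0)} ∧
    {P : Plane K | C.IsSmoothPoint P ∧ C.IsInnerGalois P ∧
      C.intersectionMultiplicity P (C.tangentLine P) = 4} =
      {Projectivization.mk K (b 2) (b.ne_zero 2), Projectivization.mk K (b 0) (b.ne_zero 0)} := by
  obtain ⟨k, l, hk, hl, e₁, e₂, e₃⟩ := T.exists_eq_cube h3 hw
  have hmem : ∀ P : Plane K, C.IsSmoothPoint P → C.IsInnerGalois P →
      P = Projectivization.mk K (b 2) (b.ne_zero 2) ∨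
      P = Projectivization.mk K (b 0) (b.ne_zero 0) := by
    intro P hs hG
    obtain ⟨s, t, hx, hy, hz⟩ := T.exists_eq_of_form_eq_zero h2 N ((N.mem_points P).1 hs.1)
    have hsum := b.sum_repr P.rep
    rw [Fin.sum_univ_three] at hsum
    by_cases hs0 : s = 0
    · left
      rw [← P.mk_rep, Projectivization.mk_eq_mk_iff']
      refine ⟨b.repr P.rep 2, ?_⟩
      rw [← hsum, hx, hy, hs0]
      simp
    by_cases ht0 : t = 0
    · right
      rw [← P.mk_rep, Projectivization.mk_eq_mk_iff']
      refine ⟨b.repr P.rep 0, ?_⟩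
      rw [← hsum, hz, hy, ht0]
      simp
    refine absurd hG (T.not_isInnerGalois h2 h3 N hk hl e₁ e₂ e₃ (x := s ^ 4) (r := t / s)
      (pow_ne_zero 4 hs0) (div_ne_zero ht0 hs0) hx ?_ ?_ hs)
    · rw [hy, eval_W]
      field_simp
    · rw [hz]
      field_simp
  have hP₁ := N.isSmoothPoint_and_intersectionMultiplicity rfl
  have hP₁G := (T.isInnerGalois_last_iff N rfl).2 (T.isGalois_W h3 hk e₁ e₂ e₃)
  have hP₂ := N.symm.isSmoothPoint_and_intersectionMultiplicity
    (P := Projectivization.mk K (b 0) (b.ne_zero 0)) (by congr 1; simp)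
  have hP₂G := (T.isInnerGalois_first_iff N rfl).2 (T.isGalois_W_div h3 hk hl e₁ e₂ e₃)
  constructor
  · ext P
    constructor
    · rintro ⟨hs, hG⟩
      exact hmem P hs hG
    · rintro (rfl | rfl)
      · exact ⟨hP₁.1, hP₁G⟩
      · exact ⟨hP₂.1, hP₂G⟩
  · ext P
    constructor
    · rintro ⟨hs, hG, -⟩
      exact hmem P hs hG
    · rintro (rfl | rfl)
      · exact ⟨hP₁.1, hP₁G, hP₁.2⟩
      · exact ⟨hP₂.1, hP₂G, hP₂.2⟩

theorem delta_eq_two [IsAlgClosed K] (h2 : (2 : K) ≠ 0) (h3 : (3 : K) ≠ 0)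
    (N : NormalForm C b) (hw : T.w₂ ^ 2 = 3 * T.w₁ * T.w₃) : C.delta = 2 ∧ C.deltaTwo = 2 := by
  obtain ⟨h, h'⟩ := T.setOf_isSmoothPoint_isInnerGalois h2 h3 N hw
  have hne : Projectivization.mk K (b 2) (b.ne_zero 2) ≠
      Projectivization.mk K (b 0) (b.ne_zero 0) := by
    rw [Ne, Projectivization.mk_eq_mk_iff']
    rintro ⟨c, hc⟩
    have := congrArg (fun v => b.repr v 2) hc
    simp at this
  rw [PlaneCurve.delta, PlaneCurve.deltaTwo, h, h', Set.encard_pair hne]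
  exact ⟨rfl, rfl⟩

/-- The coordinate change `shear`, after the one given by `b`, takes the point with parameter
`(s : t)` to the point of the model curve with parameter `(l s : t)`. -/
theorem projectivelyEquivalent [IsAlgClosed K] (h2 : (2 : K) ≠ 0) (h3 : (3 : K) ≠ 0)
    (N : NormalForm C b) (hw : T.w₂ ^ 2 = 3 * T.w₁ * T.w₃) :
    ProjectivelyEquivalent C.points (Set.range (quarticMorphism K)) := by
  obtain ⟨k, l, hk, hl, e₁, e₂, e₃⟩ := T.exists_eq_cube h3 hw
  set g : (Fin 3 → K) ≃ₗ[K] (Fin 3 → K) := b.equivFun.trans (shear hk hl) with hg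
  have hgv : ∀ v s t, b.repr v 0 = s ^ 4 →
      b.repr v 1 = T.w₁ * s ^ 3 * t + T.w₂ * s ^ 2 * t ^ 2 + T.w₃ * s * t ^ 3 →
      b.repr v 2 = t ^ 4 → g v = quarticForms ![l * s, t] := by
    intro v s t h0 h1 h2
    ext i
    fin_cases i
    · simp [hg, shear, quarticForms, h0, mul_pow]
    · simp [hg, shear, quarticForms, h0, h1, e₁, e₂, e₃]
      field_simp
      ring
    · simp [hg, shear, quarticForms, h2]
  refine ⟨g, ?_⟩
  apply Set.Subset.antisymm
  · rintro _ ⟨P, hP, rfl⟩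
    obtain ⟨s, t, hx, hy, hz⟩ := T.exists_eq_of_form_eq_zero h2 N ((N.mem_points P).1 hP)
    have hgP := hgv _ s t hx hy hz
    have hst : ![l * s, t] ≠ 0 := by
      intro h
      have h0 : g P.rep = 0 := by
        rw [hgP, h]
        ext i
        fin_cases i <;> simp [quarticForms]
      exact P.rep_nonzero (g.map_eq_zero_iff.1 h0)
    refine ⟨Projectivization.mk K _ hst, ?_⟩
    rw [quarticMorphism_mk]
    conv_rhs => rw [← P.mk_rep, Projectivization.map_mk]
    congr 1
    exact hgP.symm
  · rintro _ ⟨L, rfl⟩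
    induction L using Projectivization.ind with
    | h v hv =>
      set w : Fin 3 → K := g.symm (quarticForms v) with hw
      have hw0 : w ≠ 0 := by
        rw [hw, Ne, g.symm.map_eq_zero_iff]
        exact quarticForms_ne_zero hv
      refine ⟨Projectivization.mk K w hw0, ?_, ?_⟩
      · rw [mk_mem_points, N.eval_poly]
        set s := v 0 / l with hs
        set u : Fin 3 → K := s ^ 4 • b 0 +
          (T.w₁ * s ^ 3 * v 1 + T.w₂ * s ^ 2 * v 1 ^ 2 + T.w₃ * s * v 1 ^ 3) • b 1 +
          v 1 ^ 4 • b 2 with hu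
        have h0 : b.repr u 0 = s ^ 4 := by simp [hu]
        have h1 : b.repr u 1 =
            T.w₁ * s ^ 3 * v 1 + T.w₂ * s ^ 2 * v 1 ^ 2 + T.w₃ * s * v 1 ^ 3 := by simp [hu]
        have h2 : b.repr u 2 = v 1 ^ 4 := by simp [hu]
        have huw : w = u := by
          rw [hw, LinearEquiv.symm_apply_eq, hgv u s (v 1) h0 h1 h2, hs, mul_div_cancel₀ _ hl]
          congr 1
          ext i
          fin_cases i <;> rfl
        rw [huw, h0, h1, h2]
        exact T.form_param N s (v 1)
      · rw [quarticMorphism_mk, Projectivization.map_mk]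
        congr 1
        exact g.apply_symm_apply _

/-- If the curve contains the points `(1 : u³ + 3 u² + 3 u : u⁴)`, then `u³ + 3 u² + 3 u` is
`W(ζ u)` for some fourth root of unity `ζ`. -/
theorem w₂_sq_of_form_eq_zero [IsAlgClosed K] (h2 : (2 : K) ≠ 0) (N : NormalForm C b)
    (h : ∀ u : K, N.form 1 (3 * u + 3 * u ^ 2 + u ^ 3) (u ^ 4) = 0) :
    T.w₂ ^ 2 = 3 * T.w₁ * T.w₃ := by
  obtain ⟨i, hi⟩ := IsAlgClosed.exists_pow_nat_eq (-1 : K) (n := 2) (by norm_num)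
  set W₀ : K[X] := Polynomial.C 3 * X + Polynomial.C 3 * X ^ 2 + Polynomial.C 1 * X ^ 3 with hW₀
  set V : K → K[X] := fun ζ => W₀ - T.W.comp (Polynomial.C ζ * X) with hV
  have hVe : ∀ ζ u, (V ζ).eval u = 3 * u + 3 * u ^ 2 + u ^ 3 - T.W.eval (ζ * u) := by
    intro ζ u
    simp [hV, hW₀, eval_comp]
  have hprod : V 1 * V (-1) * (V i * V (-i)) = 0 := by
    refine Polynomial.funext fun u => ?_
    obtain ⟨s, t, hs, hy, ht⟩ := T.exists_eq_of_form_eq_zero h2 N (h u)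
    have hv : (s ^ 3 * t) ^ 4 = u ^ 4 := by
      rw [ht]
      linear_combination -t ^ 4 * (s ^ 8 + s ^ 4 + 1) * hs
    have hW : T.W.eval (s ^ 3 * t) = 3 * u + 3 * u ^ 2 + u ^ 3 := by
      rw [hy, eval_W]
      linear_combination -(T.w₂ * s ^ 2 * t ^ 2 + T.w₃ * s * t ^ 3 * (s ^ 4 + 1)) * hs
    have hfac : (s ^ 3 * t - u) * (s ^ 3 * t + u) * ((s ^ 3 * t - i * u) * (s ^ 3 * t + i * u)) =
        0 := by
      linear_combination hv - (s ^ 6 * t ^ 2 - u ^ 2) * u ^ 2 * hi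
    have hz : ∀ ζ, s ^ 3 * t = ζ * u → (V ζ).eval u = 0 := by
      intro ζ hζ
      rw [hVe, ← hζ, hW, sub_self]
    simp only [eval_mul, eval_zero]
    rcases mul_eq_zero.1 hfac with h1 | h1 <;> rcases mul_eq_zero.1 h1 with h1 | h1
    · rw [hz 1 (by linear_combination h1)]; ring
    · rw [hz (-1) (by linear_combination h1)]; ring
    · rw [hz i (by linear_combination h1)]; ring
    · rw [hz (-i) (by linear_combination h1)]; ring
  obtain ⟨ζ, hζ, hVζ⟩ : ∃ ζ : K, ζ ^ 4 = 1 ∧ V ζ = 0 := by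
    rcases mul_eq_zero.1 hprod with h1 | h1 <;> rcases mul_eq_zero.1 h1 with h1 | h1
    · exact ⟨1, by ring, h1⟩
    · exact ⟨-1, by ring, h1⟩
    · exact ⟨i, by linear_combination (i ^ 2 - 1) * hi, h1⟩
    · exact ⟨-i, by linear_combination (i ^ 2 - 1) * hi, h1⟩
  obtain ⟨-, c₃, c₂, c₁, -⟩ := coeffs_eq_zero_of_quartic_eq_zero (u₄ := (0 : K))
    (u₃ := 1 - T.w₃ * ζ ^ 3) (u₂ := 3 - T.w₂ * ζ ^ 2) (u₁ := 3 - T.w₁ * ζ) (u₀ := 0) (by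
      rw [← hVζ, hV, hW₀, W]
      simp only [C_sub, C_mul, C_pow, map_ofNat, C_0, C_1, add_comp, mul_comp, C_comp, X_comp,
        pow_comp]
      ring)
  linear_combination (-T.w₂ ^ 2 + 3 * T.w₁ * T.w₃) * hζ - (T.w₂ * ζ ^ 2 + 3) * c₂ +
    3 * T.w₁ * ζ * c₃ + 3 * c₁

end Param

/-- The form restricted to a branch `(1 : Y : X⁴)` with `Y` of order one at `X = 0`: if it vanishes,
then the contact of the branch with the line `z = 0` determines some of the coefficients. -/
theorem coeffs_of_quarticSum_eq_zero {a : ℕ → ℕ → K} {V : K[X]} (hV : V.eval 0 ≠ 0)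
    (h : quarticSum a 1 (X * V) (X ^ 4) = 0) :
    a 4 0 = 0 ∧ a 3 1 = 0 ∧ a 2 2 = 0 ∧ a 1 3 = 0 ∧ a 3 0 = -(a 0 4 * V.eval 0 ^ 4) := by
  set R : K[X] := Polynomial.C (a 3 0) + Polynomial.C (a 2 1) * (X * V) +
    Polynomial.C (a 1 2) * (X * V) ^ 2 + Polynomial.C (a 0 3) * (X * V) ^ 3 + X ^ 4 *
    (Polynomial.C (a 2 0) + Polynomial.C (a 1 1) * (X * V) + Polynomial.C (a 0 2) * (X * V) ^ 2 +
      X ^ 4 * (Polynomial.C (a 1 0) + Polynomial.C (a 0 1) * (X * V) +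
        X ^ 4 * Polynomial.C (a 0 0))) with hR
  have e : Polynomial.C (a 4 0) + X * (V * (Polynomial.C (a 3 1) + X * (V *
      (Polynomial.C (a 2 2) + X * (V * Polynomial.C (a 1 3) ) )))) +
      X ^ 4 * (Polynomial.C (a 0 4) * V ^ 4 + R) = 0 := by
    rw [← h, hR]
    simp [quarticSum, Finset.sum_range_succ]
    ring
  have h40 : a 4 0 = 0 := by simpa using congrArg (Polynomial.eval 0) e
  have e1 : V * (Polynomial.C (a 3 1) + X * (V *
      (Polynomial.C (a 2 2) + X * (V * Polynomial.C (a 1 3))))) +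
      X ^ 3 * (Polynomial.C (a 0 4) * V ^ 4 + R) = 0 := by
    apply mul_left_cancel₀ (X_ne_zero (R := K))
    rw [h40, C_0] at e
    linear_combination e
  have h31 : a 3 1 = 0 := by simpa [hV] using congrArg (Polynomial.eval 0) e1
  have e2 : V ^ 2 * (Polynomial.C (a 2 2) + X * (V * Polynomial.C (a 1 3))) +
      X ^ 2 * (Polynomial.C (a 0 4) * V ^ 4 + R) = 0 := by
    apply mul_left_cancel₀ (X_ne_zero (R := K))
    rw [h31, C_0] at e1
    linear_combination e1
  have h22 : a 2 2 = 0 := by simpa [hV] using congrArg (Polynomial.eval 0) e2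
  have e3 : V ^ 3 * Polynomial.C (a 1 3) + X * (Polynomial.C (a 0 4) * V ^ 4 + R) = 0 := by
    apply mul_left_cancel₀ (X_ne_zero (R := K))
    rw [h22, C_0] at e2
    linear_combination e2
  have h13 : a 1 3 = 0 := by simpa [hV] using congrArg (Polynomial.eval 0) e3
  have e4 : Polynomial.C (a 0 4) * V ^ 4 + R = 0 := by
    apply mul_left_cancel₀ (X_ne_zero (R := K))
    rw [h13, C_0] at e3
    linear_combination e3
  have h30 : a 0 4 * V.eval 0 ^ 4 + a 3 0 = 0 := by
    simpa [hR] using congrArg (Polynomial.eval 0) e4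
  exact ⟨h40, h31, h22, h13, by linear_combination h30⟩

/-- A quartic which is projectively equivalent to the image of `(s⁴ : s (s + t)³ : t⁴)` has an
equation in normal form, in coordinates in which it contains the points
`(1 : u³ + 3 u² + 3 u : u⁴)`. -/
theorem exists_normalForm_of_projectivelyEquivalent [Infinite K] (h3 : (3 : K) ≠ 0)
    {C : PlaneCurve K 4}
    (h : ProjectivelyEquivalent C.points (Set.range (quarticMorphism K))) :
    ∃ (b : Module.Basis (Fin 3) K (Fin 3 → K)) (N : NormalForm C b),
      ∀ u : K, N.form 1 (3 * u + 3 * u ^ 2 + u ^ 3) (u ^ 4) = 0 := by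
  obtain ⟨g, hg⟩ := h
  set S := (shear (one_ne_zero (α := K)) one_ne_zero).symm with hS
  set b : Module.Basis (Fin 3) K (Fin 3 → K) := Module.Basis.ofEquivFun (g.trans S) with hb
  have hrepr : ∀ v i, b.repr v i = S (g v) i := fun v i => by
    rw [hb, Module.Basis.ofEquivFun_repr_apply]
    rfl
  -- the points of the curve, in the coordinates with respect to `b`
  have hpt : ∀ s t : K, ![s, t] ≠ 0 → ∃ v : Fin 3 → K, MvPolynomial.eval v C.poly = 0 ∧
      b.repr v 0 = s ^ 4 ∧ b.repr v 1 = 3 * s ^ 3 * t + 3 * s ^ 2 * t ^ 2 + s * t ^ 3 ∧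
      b.repr v 2 = t ^ 4 := by
    intro s t hst
    have hmem : quarticMorphism K (Projectivization.mk K _ hst) ∈
        Set.range (quarticMorphism K) := ⟨_, rfl⟩
    rw [← hg] at hmem
    obtain ⟨P, hP, hPq⟩ := hmem
    rw [quarticMorphism_mk] at hPq
    conv_lhs at hPq => rw [← P.mk_rep, Projectivization.map_mk]
    rw [Projectivization.mk_eq_mk_iff'] at hPq
    obtain ⟨c, hc⟩ := hPq
    have hc0 : c ≠ 0 := by
      rintro rfl
      rw [zero_smul] at hc
      exact P.rep_nonzero (g.map_eq_zero_iff.1 hc.symm)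
    have hgv : g (c⁻¹ • P.rep) = quarticForms ![s, t] := by
      rw [map_smul]
      change c⁻¹ • (g : (Fin 3 → K) →ₗ[K] (Fin 3 → K)) P.rep = _
      rw [← hc, smul_smul, inv_mul_cancel₀ hc0, one_smul]
    refine ⟨c⁻¹ • P.rep, ?_, ?_, ?_, ?_⟩
    · have hP0 : MvPolynomial.eval P.rep C.poly = 0 := hP
      rw [eval_smul_poly, hP0, mul_zero]
    · rw [hrepr, hgv]
      simp [hS, shear, quarticForms]
    · rw [hrepr, hgv]
      simp [hS, shear, quarticForms]
      ring
    · rw [hrepr, hgv]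
      simp [hS, shear, quarticForms]
  obtain ⟨a, ha⟩ := exists_poly_eq_quarticSum C b
  have hpta : ∀ s t : K, ![s, t] ≠ 0 → quarticSum a (s ^ 4)
      (3 * s ^ 3 * t + 3 * s ^ 2 * t ^ 2 + s * t ^ 3) (t ^ 4) = 0 := by
    intro s t hst
    obtain ⟨v, hv, h0, h1, h2⟩ := hpt s t hst
    have h4 := map_quarticSum a (MvPolynomial.aeval v : MvPolynomial (Fin 3) K →ₐ[K] K)
      (coordForm b 0) (coordForm b 1) (coordForm b 2)
    rw [← ha] at h4
    simp only [MvPolynomial.aeval_eq_eval] at h4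
    rw [eval_coordForm, eval_coordForm, eval_coordForm, h0, h1, h2] at h4
    exact h4.symm.trans hv
  have hV1 : quarticSum a 1 (X * (3 + 3 * X + X ^ 2) : K[X]) (X ^ 4) = 0 := by
    refine Polynomial.funext fun u => ?_
    have h4 := map_quarticSum a (aeval u : K[X] →ₐ[K] K) 1 (X * (3 + 3 * X + X ^ 2) : K[X]) (X ^ 4)
    simp only [coe_aeval_eq_eval] at h4
    refine h4.trans ?_
    have h5 := hpta 1 u (fun h => one_ne_zero (congrFun h 0))
    simp only [eval_mul, eval_add, eval_pow, eval_X, eval_one, eval_ofNat, eval_zero]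
    rw [← h5]
    congr 1 <;> ring
  have hV2 : quarticSum (fun i j => a (4 - i - j) j) 1 (X * (1 + 3 * X + 3 * X ^ 2) : K[X])
      (X ^ 4) = 0 := by
    refine Polynomial.funext fun u => ?_
    have h4 := map_quarticSum (fun i j => a (4 - i - j) j) (aeval u : K[X] →ₐ[K] K) 1
      (X * (1 + 3 * X + 3 * X ^ 2) : K[X]) (X ^ 4)
    simp only [coe_aeval_eq_eval] at h4
    refine h4.trans ?_
    have h5 := hpta u 1 (fun h => one_ne_zero (congrFun h 1))
    simp only [eval_mul, eval_add, eval_pow, eval_X, eval_one, eval_ofNat, eval_zero]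
    rw [← h5]
    simp [quarticSum, Finset.sum_range_succ]
    ring
  obtain ⟨h40, h31, h22, h13, h30⟩ := coeffs_of_quarticSum_eq_zero (by simpa using h3) hV1
  obtain ⟨h00, h01, h02, h03, h10⟩ := coeffs_of_quarticSum_eq_zero (by simp) hV2
  simp at h30 h10 h00 h01 h02 h03
  -- without the term in `y⁴`, the equation is divisible by `x`
  have h04 : a 0 4 ≠ 0 := by
    intro h04
    rw [h04] at h30 h10
    have hfac : C.poly = coordForm b 0 * (coordForm b 2 *
        (MvPolynomial.C (a 2 0) * coordForm b 0 * coordForm b 2 +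
        MvPolynomial.C (a 2 1) * coordForm b 0 * coordForm b 1 +
        MvPolynomial.C (a 1 1) * coordForm b 1 * coordForm b 2 +
        MvPolynomial.C (a 1 2) * coordForm b 1 ^ 2)) := by
      rw [ha]
      simp [quarticSum, Finset.sum_range_succ, h00, h01, h02, h03, h40, h31, h22, h13, h04, h30,
        h10]
      ring
    have hnu : ∀ p : MvPolynomial (Fin 3) K, MvPolynomial.eval 0 p = 0 → ¬ IsUnit p := by
      intro p hp hu
      have := hu.map (MvPolynomial.eval (0 : Fin 3 → K))
      rw [hp] at this
      exact not_isUnit_zero this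
    have hz : ∀ i, MvPolynomial.eval 0 (coordForm b i) = 0 := fun i => by
      rw [eval_coordForm]
      simp
    rcases C.irreducible.isUnit_or_isUnit hfac with hu | hu
    · exact hnu _ (hz 0) hu
    · exact hnu _ (by rw [map_mul, hz 2, zero_mul]) hu
  have h30' : a 3 0 ≠ 0 := by
    rw [h30]
    exact neg_ne_zero.2 (mul_ne_zero h04 (pow_ne_zero 4 h3))
  have h10' : a 1 0 ≠ 0 := by
    rw [h10]
    exact neg_ne_zero.2 h04
  obtain ⟨N⟩ := nonempty_normalForm ha h00 h01 h02 h03 h40 h31 h22 h13 h04 h30' h10'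
  refine ⟨b, N, fun u => ?_⟩
  obtain ⟨v, hv, h0, h1, h2⟩ := hpt 1 u (fun h => one_ne_zero (congrFun h 0))
  rw [N.eval_poly, h0, h1, h2] at hv
  rw [← hv]
  congr 1 <;> ring

end GaloisPoint

end

theorem proposition1 {K : Type*} [Field K] [IsAlgClosed K] (p : ℕ) [CharP K p]
    (hp2 : p ≠ 2) (hp3 : p ≠ 3)
    (C : GaloisPoint.PlaneCurve K 4) (hC : C.IsRational) :
    (2 ≤ C.deltaTwo ↔
      GaloisPoint.ProjectivelyEquivalent C.points (Set.range (GaloisPoint.quarticMorphism K))) ∧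
    (2 ≤ C.deltaTwo → C.delta = 2 ∧ C.deltaTwo = 2) := by
  have hchar : ∀ q : ℕ, q.Prime → p ≠ q → (q : K) ≠ 0 := by
    intro q hq hpq h
    rw [CharP.cast_eq_zero_iff K p q] at h
    rcases (Nat.dvd_prime hq).1 h with h1 | h1
    · exact CharP.char_ne_one K p h1
    · exact hpq h1
  have h2 : (2 : K) ≠ 0 := by exact_mod_cast hchar 2 Nat.prime_two hp2
  have h3 : (3 : K) ≠ 0 := by exact_mod_cast hchar 3 Nat.prime_three hp3
  have hinf : Infinite K := IsAlgClosed.instInfinite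
  have hforward : 2 ≤ C.deltaTwo →
      ∃ (b : Module.Basis (Fin 3) K (Fin 3 → K)) (_ : GaloisPoint.NormalForm C b)
        (T : GaloisPoint.Param C b), T.w₂ ^ 2 = 3 * T.w₁ * T.w₃ := by
    intro h
    obtain ⟨b, ⟨N⟩, hG⟩ := C.exists_normalForm_of_two_le_deltaTwo h
    obtain ⟨T⟩ := N.nonempty_param hC
    exact ⟨b, N, T, T.w₂_sq_of_isGalois h2 ((T.isInnerGalois_last_iff N rfl).1 hG)⟩
  refine ⟨⟨fun h => ?_, fun h => ?_⟩, fun h => ?_⟩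
  · obtain ⟨b, N, T, hw⟩ := hforward h
    exact T.projectivelyEquivalent h2 h3 N hw
  · obtain ⟨b, N, hN⟩ := GaloisPoint.exists_normalForm_of_projectivelyEquivalent h3 h
    obtain ⟨T⟩ := N.nonempty_param hC
    exact (T.delta_eq_two h2 h3 N (T.w₂_sq_of_form_eq_zero h2 N hN)).2.ge
  · obtain ⟨b, N, T, hw⟩ := hforward h
    exact T.delta_eq_two h2 h3 N hw
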